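/- Let $d\in\mathbb{N}$, let $0<\alpha\le 2$, and let $\Sigma\subset\mathbb{R}^d$ be a compact set of $d$-dimensional Lebesgue measure zero; write $N:=\mathbb{R}^d\setminus\Sigma$. Let $C_0^\infty(N)$ be the space of smooth complex-valued functions with compact support contained in $N$, and let $(-\Delta)^{\alpha/2}f=(|\xi|^\alpha\hat f)^\vee$, where $\hat{\ }$ and ${}^\vee$ denote the Fourier transform and its inverse. A densely defined symmetric operator in a Hilbert space is called essentially self-adjoint if it has a unique self-adjoint extension. Let $\gamma_\alpha:\mathbb{R}^d\to[0,\infty]$ be the Bessel kernel of order $\alpha$, that is, the kernel of $(I-\Delta)^{-\alpha/2}$, whose Fourier transform is $(1+|\xi|^2)^{-\alpha/2}$, \[\gamma_\alpha(x)=\frac{1}{\Gamma(\alpha/2)}\int_0^\infty t^{\alpha/2-1}e^{-t}(4\pi t)^{-d/2}e^{-|x|^2/(4t)}\,dt ,\] and for $E\subset\mathbb{R}^d$ let \[\operatorname{cap}_{\alpha,2}(E)=\inf\left\{\|f\|_{L^2(\mathbb{R}^d)}^2:\ f\in L^2(\mathbb{R}^d),\ f\ge 0,\ \int_{\mathbb{R}^d}\gamma_\alpha(x-y)f(y)\,dy\ge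 1\ \text{for all } x\in E\right\},\] with $\inf\emptyset=+\infty$. Then the operator $((-\Delta)^{\alpha/2},C_0^\infty(N))$ is essentially self-adjoint in the complex Hilbert space $L^2(\mathbb{R}^d)$ if and only if $\operatorname{cap}_{\alpha,2}(\Sigma)=0$. -/

import Mathlib

open MeasureTheory FourierTransform
open scoped ENNReal NNReal ContDiff

/-- A linear operator `A`, defined on a subspace of a complex Hilbert space `H`, is *essentially
self-adjoint* if it is densely defined and symmetric and has a unique self-adjoint extension.
(`A ≤ B` means that `B` extends `A`.) -/
def IsEssentiallySelfAdjoint {H : Type*} [NormedAddCommGroup H] [InnerProductSpace ℂ H]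
    [CompleteSpace H] (A : H →ₗ.[ℂ] H) : Prop :=
  Dense (A.domain : Set H) ∧ A.IsFormalAdjoint A ∧ ∃! B : H →ₗ.[ℂ] H, A ≤ B ∧ IsSelfAdjoint B

namespace FractionalLaplacian

variable {d : ℕ}

/-- The complex Hilbert space `L²(ℝᵈ)`. -/
abbrev L2 (d : ℕ) : Type := Lp ℂ 2 (volume : Measure (EuclideanSpace ℝ (Fin d)))

/-- The space `C₀^∞(ℝᵈ ∖ S)` of smooth functions whose support is compact and contained in
`ℝᵈ ∖ S`, as a subspace of `L²(ℝᵈ)`. -/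
def testFunctions (S : Set (EuclideanSpace ℝ (Fin d))) : Submodule ℂ (L2 d) where
  carrier := {u | ∃ φ : EuclideanSpace ℝ (Fin d) → ℂ, ContDiff ℝ ∞ φ ∧ HasCompactSupport φ ∧
    tsupport φ ⊆ Sᶜ ∧ u =ᵐ[volume] φ}
  zero_mem' := ⟨0, contDiff_zero_fun, HasCompactSupport.zero, by simp [tsupport],
    Lp.coeFn_zero ℂ 2 volume⟩
  add_mem' := by
    rintro u v ⟨φ, hφ, hφc, hφS, hu⟩ ⟨ψ, hψ, hψc, hψS, hv⟩
    refine ⟨φ + ψ, hφ.add hψ, hφc.add hψc,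
      (tsupport_add φ ψ).trans (Set.union_subset hφS hψS), ?_⟩
    exact (Lp.coeFn_add u v).trans (hu.add hv)
  smul_mem' := by
    rintro c u ⟨φ, hφ, hφc, hφS, hu⟩
    refine ⟨c • φ, contDiff_const.smul hφ, hφc.smul_left (f := fun _ => c), ?_, ?_⟩
    · exact (closure_mono (Function.support_const_smul_subset c φ)).trans hφS
    · exact (Lp.coeFn_smul c u).trans (hu.const_smul c)

/-- The Fourier multiplier `|ξ|^α`. Mathlib's Fourier transform is
`𝓕 u ξ = ∫ exp (-2πi⟨x, ξ⟩) u x dx`, so that the frequency is `2πξ`. -/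
noncomputable def symbol (α : ℝ) (ξ : EuclideanSpace ℝ (Fin d)) : ℝ :=
  (2 * Real.pi * ‖ξ‖) ^ α

theorem memLp_symbol_smul_fourier {α : ℝ} (hα : 0 < α) {S : Set (EuclideanSpace ℝ (Fin d))}
    {u : L2 d} (hu : u ∈ testFunctions S) :
    MemLp (fun ξ => symbol α ξ • (𝓕 u : L2 d) ξ) 2 volume := by
  obtain ⟨φ, hφ, hφc, -, huφ⟩ := hu
  set f := hφc.toSchwartzMap hφ with hf
  have huf : u = f.toLp 2 := by
    apply Lp.ext
    filter_upwards [huφ, f.coeFn_toLp 2 volume] with x h1 h2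
    rw [h1, h2]; rfl
  rw [huf, SchwartzMap.toLp_fourier_eq]
  set g : SchwartzMap (EuclideanSpace ℝ (Fin d)) ℂ := 𝓕 f
  have hT := Function.hasTemperateGrowth_one_add_norm_sq_rpow (EuclideanSpace ℝ (Fin d)) (α / 2)
  set h : SchwartzMap (EuclideanSpace ℝ (Fin d)) ℂ := SchwartzMap.smulLeftCLM ℂ
    (fun x : EuclideanSpace ℝ (Fin d) => (1 + ‖x‖ ^ 2) ^ (α / 2)) g with hh
  have hm : MemLp ((2 * Real.pi) ^ α • (h : EuclideanSpace ℝ (Fin d) → ℂ)) 2 volume :=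
    MemLp.const_smul (SchwartzMap.memLp h 2 volume) _
  refine MemLp.mono (E := ℂ) hm ?_ ?_
  · refine AEStronglyMeasurable.smul (𝕜 := ℝ) (β := ℂ) (Measurable.aestronglyMeasurable ?_)
      (Lp.aestronglyMeasurable _)
    unfold symbol; fun_prop
  · filter_upwards [g.coeFn_toLp 2 volume] with ξ hξ
    rw [hξ, Pi.smul_apply, hh, SchwartzMap.smulLeftCLM_apply_apply hT, norm_smul,
      norm_smul, norm_smul, ← mul_assoc]
    gcongr
    have h0 : 0 ≤ 1 + ‖ξ‖ ^ 2 := by positivity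
    rw [symbol, Real.mul_rpow (by positivity) (norm_nonneg _), norm_mul]
    gcongr
    rw [Real.norm_of_nonneg (by positivity), Real.norm_of_nonneg (by positivity)]
    have : ‖ξ‖ ^ α = (‖ξ‖ ^ 2) ^ (α / 2) := by
      rw [← Real.rpow_natCast, ← Real.rpow_mul (norm_nonneg _)]; congr 1; push_cast; ring
    rw [this]
    gcongr
    linarith

/-- The operator `((-Δ)^{α/2}, C₀^∞(ℝᵈ ∖ S))` in `L²(ℝᵈ)`: it maps `u ∈ C₀^∞(ℝᵈ ∖ S)` to the
inverse Fourier transform of `|ξ|^α û`. -/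
noncomputable def fracLaplacian {α : ℝ} (hα : 0 < α) (S : Set (EuclideanSpace ℝ (Fin d))) :
    L2 d →ₗ.[ℂ] L2 d where
  domain := testFunctions S
  toFun :=
    { toFun := fun u => 𝓕⁻ (memLp_symbol_smul_fourier hα u.2).toLp
      map_add' := by
        intro u v
        rw [← FourierTransform.fourierInv_add, ← MemLp.toLp_add]
        congr 1
        apply MemLp.toLp_congr
        have h := Lp.coeFn_add (𝓕 (u : L2 d)) (𝓕 (v : L2 d))
        rw [← FourierTransform.fourier_add] at h
        filter_upwards [h] with ξ h
        simp only [Submodule.coe_add, h, Pi.add_apply, smul_add]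
      map_smul' := by
        intro c u
        rw [RingHom.id_apply, ← FourierTransform.fourierInv_smul, ← MemLp.toLp_const_smul]
        congr 1
        apply MemLp.toLp_congr
        have h := Lp.coeFn_smul c (𝓕 (u : L2 d))
        rw [← FourierTransform.fourier_smul] at h
        filter_upwards [h] with ξ h
        simp only [Submodule.coe_smul, h, Pi.smul_apply, smul_comm c] }

/-- The integrand
`Γ(α/2)⁻¹ t^{α/2 - 1} e^{-t} · (4πt)^{-d/2} e^{-|x|²/(4t)}` of the Bessel kernel. -/
noncomputable def besselDensity (α : ℝ) (t : ℝ) (x : EuclideanSpace ℝ (Fin d)) : ℝ :=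
  ((Real.Gamma (α / 2))⁻¹ * t ^ (α / 2 - 1) * Real.exp (-t)) *
    ((4 * Real.pi * t) ^ (-(d : ℝ) / 2) * Real.exp (-‖x‖ ^ 2 / (4 * t)))

/-- The Bessel kernel `γ_α` as a `[0, ∞]`-valued function defined at every point,
`γ_α(x) = Γ(α/2)⁻¹ ∫₀^∞ t^{α/2 - 1} e^{-t} (4πt)^{-d/2} e^{-|x|²/(4t)} dt`. For `α > 0` it is
integrable and its Fourier transform is `(1 + |ξ|²)^{-α/2}`, see `lintegral_besselKernel` and
`fourier_besselKernel` below. -/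
noncomputable def besselKernel (α : ℝ) (x : EuclideanSpace ℝ (Fin d)) : ℝ≥0∞ :=
  ∫⁻ t in Set.Ioi (0 : ℝ), ENNReal.ofReal (besselDensity α t x)

theorem besselDensity_nonneg {α : ℝ} (hα : 0 < α) {t : ℝ} (ht : 0 < t)
    (x : EuclideanSpace ℝ (Fin d)) : 0 ≤ besselDensity α t x := by
  unfold besselDensity; positivity

theorem measurable_besselDensity (α : ℝ) : Measurable (fun p : ℝ × EuclideanSpace ℝ (Fin d) =>
    besselDensity α p.1 p.2) := by
  unfold besselDensity; fun_prop

theorem fourier_besselDensity {α t : ℝ} (ht : 0 < t) (ξ : EuclideanSpace ℝ (Fin d)) :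
    ∫ x : EuclideanSpace ℝ (Fin d), Real.fourierChar (-inner ℝ x ξ) • (besselDensity α t x : ℂ) =
      (((Real.Gamma (α / 2))⁻¹ * t ^ (α / 2 - 1) *
        Real.exp (-((1 + (2 * Real.pi * ‖ξ‖) ^ 2) * t)) : ℝ) : ℂ) := by
  have hb : 0 < ((1 / (4 * t) : ℝ) : ℂ).re := by rw [Complex.ofReal_re]; positivity
  have h := fourier_gaussian_innerProductSpace hb ξ
  rw [Real.fourier_eq] at h
  have e : ∀ x : EuclideanSpace ℝ (Fin d),
      Real.fourierChar (-inner ℝ x ξ) • (besselDensity α t x : ℂ) =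
      (((Real.Gamma (α / 2))⁻¹ * t ^ (α / 2 - 1) * Real.exp (-t) *
        (4 * Real.pi * t) ^ (-(d : ℝ) / 2) : ℝ) : ℂ) *
      (Real.fourierChar (-inner ℝ x ξ) • Complex.exp (-((1 / (4 * t) : ℝ) : ℂ) * ‖x‖ ^ 2)) := by
    intro x
    have : Complex.exp (-((1 / (4 * t) : ℝ) : ℂ) * ‖x‖ ^ 2) =
        ((Real.exp (-‖x‖ ^ 2 / (4 * t)) : ℝ) : ℂ) := by
      push_cast; congr 1; ring
    rw [this, Circle.smul_def, Circle.smul_def, besselDensity, smul_eq_mul, smul_eq_mul]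
    push_cast; ring
  simp_rw [e]
  rw [integral_const_mul, h, finrank_euclideanSpace_fin]
  have h1 : ((Real.pi : ℂ) / ((1 / (4 * t) : ℝ) : ℂ)) ^ ((d : ℂ) / 2) =
      (((4 * Real.pi * t) ^ ((d : ℝ) / 2) : ℝ) : ℂ) := by
    rw [Complex.ofReal_cpow (by positivity)]
    congr 1
    · push_cast; field_simp
    · push_cast; ring
  have h2 : Complex.exp (-(Real.pi : ℂ) ^ 2 * (‖ξ‖ : ℂ) ^ 2 / ((1 / (4 * t) : ℝ) : ℂ)) =
      ((Real.exp (-((2 * Real.pi * ‖ξ‖) ^ 2 * t)) : ℝ) : ℂ) := by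
    push_cast; congr 1; field_simp; ring
  rw [h1, h2, ← Complex.ofReal_mul, ← Complex.ofReal_mul]
  congr 1
  have h3 : (4 * Real.pi * t) ^ (-(d : ℝ) / 2) * (4 * Real.pi * t) ^ ((d : ℝ) / 2) = 1 := by
    rw [← Real.rpow_add (by positivity)]; simp [neg_div]
  have h4 : Real.exp (-((1 + (2 * Real.pi * ‖ξ‖) ^ 2) * t)) =
      Real.exp (-t) * Real.exp (-((2 * Real.pi * ‖ξ‖) ^ 2 * t)) := by
    rw [← Real.exp_add]; congr 1; ring
  rw [h4]
  linear_combination ((Real.Gamma (α / 2))⁻¹ * t ^ (α / 2 - 1) * Real.exp (-t) *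
    Real.exp (-((2 * Real.pi * ‖ξ‖) ^ 2 * t))) * h3

theorem integrable_besselDensity {α t : ℝ} (ht : 0 < t) :
    Integrable (fun x : EuclideanSpace ℝ (Fin d) => besselDensity α t x) := by
  have hb : 0 < ((1 / (4 * t) : ℝ) : ℂ).re := by rw [Complex.ofReal_re]; positivity
  have h := GaussianFourier.integrable_cexp_neg_mul_sq_norm_add
    (V := EuclideanSpace ℝ (Fin d)) hb 0 0
  have h2 := (h.norm.const_mul ((4 * Real.pi * t) ^ (-(d : ℝ) / 2))).const_mul
    ((Real.Gamma (α / 2))⁻¹ * t ^ (α / 2 - 1) * Real.exp (-t))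
  refine h2.congr (Filter.Eventually.of_forall fun x => ?_)
  have : (-((1 / (4 * t) : ℝ) : ℂ) * (‖x‖ : ℂ) ^ 2 + 0 * ((inner ℝ 0 x : ℝ) : ℂ)) =
      ((-‖x‖ ^ 2 / (4 * t) : ℝ) : ℂ) := by
    push_cast; ring
  simp only [this, besselDensity, Complex.norm_exp, Complex.ofReal_re]

theorem integrable_besselDensity_prod {α : ℝ} (hα : 0 < α) :
    Integrable (fun p : EuclideanSpace ℝ (Fin d) × ℝ => besselDensity α p.2 p.1)
      (volume.prod (volume.restrict (Set.Ioi 0))) := by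
  have hm : AEStronglyMeasurable
      (fun p : EuclideanSpace ℝ (Fin d) × ℝ => besselDensity α p.2 p.1)
      (volume.prod (volume.restrict (Set.Ioi 0))) :=
    ((measurable_besselDensity α).comp measurable_swap).aestronglyMeasurable
  rw [integrable_prod_iff' hm]
  have hpos : ∀ᵐ t : ℝ ∂volume.restrict (Set.Ioi 0), 0 < t :=
    ae_restrict_mem measurableSet_Ioi
  refine ⟨hpos.mono fun t ht => integrable_besselDensity ht, ?_⟩
  have hi : IntegrableOn (fun t : ℝ => (Real.Gamma (α / 2))⁻¹ *
      (Real.exp (-t) * t ^ (α / 2 - 1))) (Set.Ioi 0) :=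
    (Real.GammaIntegral_convergent (by positivity)).const_mul _
  refine hi.congr (hpos.mono fun t ht => ?_)
  have h0 := fourier_besselDensity (α := α) ht (0 : EuclideanSpace ℝ (Fin d))
  simp only [inner_zero_right, neg_zero, AddChar.map_zero_eq_one, one_smul, norm_zero,
    mul_zero, integral_complex_ofReal] at h0
  have h1 := Complex.ofReal_injective h0
  have h2 : ∫ x : EuclideanSpace ℝ (Fin d), ‖besselDensity α t x‖ =
      ∫ x : EuclideanSpace ℝ (Fin d), besselDensity α t x :=
    integral_congr_ae (Filter.Eventually.of_forall fun x =>
      Real.norm_of_nonneg (besselDensity_nonneg hα ht x))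
  simp only [h2, h1]
  norm_num
  ring

theorem toReal_besselKernel {α : ℝ} (hα : 0 < α) (x : EuclideanSpace ℝ (Fin d)) :
    (besselKernel α x).toReal = ∫ t in Set.Ioi (0 : ℝ), besselDensity α t x := by
  rw [integral_eq_lintegral_of_nonneg_ae]
  · rfl
  · exact (ae_restrict_mem measurableSet_Ioi).mono fun t ht => besselDensity_nonneg hα ht x
  · exact ((measurable_besselDensity α).comp measurable_prodMk_right).aestronglyMeasurable

/-- The Fourier transform of `γ_α` is `(1 + |ξ|²)^{-α/2}`, at the frequency `2πξ`. -/
theorem fourier_besselKernel {α : ℝ} (hα : 0 < α) (ξ : EuclideanSpace ℝ (Fin d)) :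
    𝓕 (fun x : EuclideanSpace ℝ (Fin d) => ((besselKernel α x).toReal : ℂ)) ξ =
      (((1 + (2 * Real.pi * ‖ξ‖) ^ 2) ^ (-α / 2) : ℝ) : ℂ) := by
  have hr : 0 < 1 + (2 * Real.pi * ‖ξ‖) ^ 2 := by positivity
  rw [Real.fourier_eq]
  have e : ∀ x : EuclideanSpace ℝ (Fin d),
      Real.fourierChar (-inner ℝ x ξ) • ((besselKernel α x).toReal : ℂ) =
      ∫ t in Set.Ioi (0 : ℝ), Real.fourierChar (-inner ℝ x ξ) • (besselDensity α t x : ℂ) := by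
    intro x
    simp only [Circle.smul_def, smul_eq_mul]
    rw [toReal_besselKernel hα, integral_const_mul, integral_complex_ofReal]
  simp_rw [e]
  rw [integral_integral_swap]
  · have hc : ∀ t ∈ Set.Ioi (0 : ℝ), (∫ x : EuclideanSpace ℝ (Fin d),
        Real.fourierChar (-inner ℝ x ξ) • (besselDensity α t x : ℂ)) =
        (((Real.Gamma (α / 2))⁻¹ * (t ^ (α / 2 - 1) *
          Real.exp (-((1 + (2 * Real.pi * ‖ξ‖) ^ 2) * t))) : ℝ) : ℂ) := by
      intro t ht
      rw [fourier_besselDensity ht, mul_assoc]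
    rw [setIntegral_congr_fun measurableSet_Ioi hc, integral_complex_ofReal, integral_const_mul,
      Real.integral_rpow_mul_exp_neg_mul_Ioi (by positivity) hr]
    congr 1
    have : Real.Gamma (α / 2) ≠ 0 := (Real.Gamma_pos_of_pos (by positivity)).ne'
    rw [one_div, Real.inv_rpow hr.le, neg_div, Real.rpow_neg hr.le]
    field_simp
  · have h := (integrable_besselDensity_prod (d := d) hα).ofReal (𝕜 := ℂ)
    refine h.mono ?_ (Filter.Eventually.of_forall fun p => ?_)
    · refine AEStronglyMeasurable.smul ?_ h.aestronglyMeasurable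
      refine Continuous.aestronglyMeasurable ?_
      fun_prop
    · simp [Function.uncurry, Circle.smul_def, Circle.norm_coe]

theorem lintegral_besselKernel {α : ℝ} (hα : 0 < α) :
    ∫⁻ x : EuclideanSpace ℝ (Fin d), besselKernel α x = 1 := by
  have hpos : ∀ᵐ p : EuclideanSpace ℝ (Fin d) × ℝ ∂volume.prod (volume.restrict (Set.Ioi 0)),
      0 ≤ besselDensity α p.2 p.1 := by
    have : ∀ᵐ t : ℝ ∂volume.restrict (Set.Ioi 0), 0 < t := ae_restrict_mem measurableSet_Ioi
    exact (Measure.quasiMeasurePreserving_snd.ae this).mono fun p hp =>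
      besselDensity_nonneg hα hp p.1
  have hi := integrable_besselDensity_prod (d := d) hα
  have h1 : ∫⁻ x : EuclideanSpace ℝ (Fin d), besselKernel α x =
      ENNReal.ofReal (∫ x : EuclideanSpace ℝ (Fin d), (besselKernel α x).toReal) := by
    simp_rw [toReal_besselKernel hα]
    rw [← integral_prod _ hi, ofReal_integral_eq_lintegral_ofReal hi hpos, lintegral_prod]
    · rfl
    · exact hi.aestronglyMeasurable.aemeasurable.ennreal_ofReal
  have h2 := fourier_besselKernel hα (0 : EuclideanSpace ℝ (Fin d))
  rw [Real.fourier_eq] at h2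
  simp only [inner_zero_right, neg_zero, AddChar.map_zero_eq_one, one_smul, norm_zero,
    mul_zero, integral_complex_ofReal] at h2
  rw [h1, Complex.ofReal_injective h2]
  norm_num

/-- The Bessel potential `γ_α ∗ f`, defined at every point, of a function `f ≥ 0`. -/
noncomputable def besselPotential (α : ℝ) (f : EuclideanSpace ℝ (Fin d) → ℝ)
    (x : EuclideanSpace ℝ (Fin d)) : ℝ≥0∞ :=
  ∫⁻ y, besselKernel α (x - y) * ENNReal.ofReal (f y)

/-- The capacity `cap_{α,2}(E)`; the infimum over the empty set is `∞`. -/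
noncomputable def capacity (α : ℝ) (E : Set (EuclideanSpace ℝ (Fin d))) : ℝ≥0∞ :=
  ⨅ (f : Lp ℝ 2 (volume : Measure (EuclideanSpace ℝ (Fin d)))) (_ : 0 ≤ f)
    (_ : ∀ x ∈ E, 1 ≤ besselPotential α f x), ENNReal.ofReal (‖f‖ ^ 2)

end FractionalLaplacian

/-! Write A for the operator and frequencies in the convention where -Δ has symbol |ξ|². The Fourier
multiplier R = (1 + |ξ|^α)⁻¹ is bounded, self-adjoint and inverts A + 1, so A is essentially
self-adjoint exactly when the range of A + 1 is dense (`isEssentiallySelfAdjoint_iff`): a vector k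
orthogonal to the range gives a second inverse R + k⊗k and hence a second extension, while a dense
range forces every self-adjoint extension to be R⁻¹ - 1. As 1 + |ξ|^α and (1 + |ξ|²)^{α/2} are
comparable, the condition becomes density of (1 - Δ)^{α/2} C₀^∞(N) in L²
(`isEssentiallySelfAdjoint_fracLaplacian_iff`).

If this space is dense, take a cutoff χ equal to 1 on Σ and a test function φ on N with (1 -
Δ)^{α/2}(χ - φ) small in L². Since χ - φ equals 1 on Σ and is the Bessel potential of that small
function, the modulus of the latter is admissible for the capacity, which must vanish
(`capacity_eq_zero_of_forall_inner`).

If the capacity is zero, truncating and mollifying almost optimal densities gives Schwartz functions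
u ≥ 0 that are at least 1 near Σ and have ‖(1 - Δ)^{α/2} u‖ arbitrarily small
(`exists_besselOp_le_of_capacity_eq_zero`). Let H be a smooth step from 0 to 1. For a test function
φ on the whole space, φ - H(u)φ vanishes near Σ, so it remains to make H(u)φ small. This is the
truncation inequality ‖(1 - Δ)^β (H(u)φ)‖ ≤ C ‖(1 - Δ)^β u‖ for u ≥ 0 and 0 < β ≤ 1
(`exists_norm_besselOp_truncMul_le`), with C independent of u.

For β = 1 the dangerous term is H''(u)(∂u)². It is dominated by (∂u)²/(1 + u), whose L² norm an
integration by parts bounds by that of ∂∂u (`integral_sq_lineDerivOp_div_le`). For β < 1 one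
interpolates between this bound and the Lipschitz bound in L². The map u ↦ H(u)φ is nonlinear and
needs u ≥ 0, so the approximants are taken from the heat semigroup, which preserves positivity.
Density of compactly supported functions in the norm ‖(1 - Δ) ·‖ on the Schwartz space then finishes
the argument. -/

/-! ### Abstract criterion for essential self-adjointness -/

section EssentialSelfAdjointness

variable {H : Type*} [NormedAddCommGroup H] [InnerProductSpace ℂ H]

/-- The operator `T⁻¹ - 1` for an injective bounded operator `T`. -/
noncomputable def invSubOne (T : H →L[ℂ] H) (hT : Function.Injective T) : H →ₗ.[ℂ] H where
  domain := LinearMap.range (T : H →ₗ[ℂ] H)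
  toFun := ((LinearEquiv.ofInjective (T : H →ₗ[ℂ] H) hT).symm : _ →ₗ[ℂ] H) -
    (LinearMap.range (T : H →ₗ[ℂ] H)).subtype

theorem mem_invSubOne_domain (T : H →L[ℂ] H) (hT : Function.Injective T) (x : H) :
    T x ∈ (invSubOne T hT).domain := ⟨x, rfl⟩

theorem invSubOne_apply (T : H →L[ℂ] H) (hT : Function.Injective T) (x : H)
    (y : (invSubOne T hT).domain) (hy : (y : H) = T x) :
    invSubOne T hT y = x - T x := by
  obtain rfl : y = ⟨T x, ⟨x, rfl⟩⟩ := Subtype.ext hy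
  change (LinearEquiv.ofInjective (T : H →ₗ[ℂ] H) hT).symm ⟨T x, ⟨x, rfl⟩⟩ - T x = x - T x
  congr 1
  rw [LinearEquiv.symm_apply_eq]
  rfl

/-- The range of `T` is dense because its orthogonal complement is the kernel of the symmetric
operator `T`. If y lies in the domain of the adjoint B*, pairing with T x gives y = T (B* y + y), so
the adjoint has no larger domain. -/
theorem isSelfAdjoint_invSubOne [CompleteSpace H] (T : H →L[ℂ] H) (hT : Function.Injective T)
    (hs : IsSelfAdjoint T) : IsSelfAdjoint (invSubOne T hT) := by
  have hsym : ∀ x y, inner ℂ (T x) y = inner ℂ x (T y) := fun x y => by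
    rw [← ContinuousLinearMap.adjoint_inner_right, hs.adjoint_eq]
  have hd : Dense ((invSubOne T hT).domain : Set H) := by
    change Dense ((LinearMap.range (T : H →ₗ[ℂ] H) : Submodule ℂ H) : Set H)
    rw [Submodule.dense_iff_topologicalClosure_eq_top,
      Submodule.topologicalClosure_eq_top_iff, Submodule.eq_bot_iff]
    intro y hy
    rw [Submodule.mem_orthogonal] at hy
    apply hT
    rw [map_zero]
    refine ext_inner_left ℂ fun v => ?_
    rw [← hsym, inner_zero_right]
    exact hy _ ⟨v, rfl⟩
  rw [LinearPMap.isSelfAdjoint_def]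
  apply le_antisymm
  · have key : ∀ y : (LinearPMap.adjoint (invSubOne T hT)).domain,
        (y : H) = T (LinearPMap.adjoint (invSubOne T hT) y + y) := by
      intro y
      refine ext_inner_right ℂ fun x => ?_
      have h := LinearPMap.adjoint_isFormalAdjoint hd y ⟨T x, ⟨x, rfl⟩⟩
      rw [invSubOne_apply T hT x _ rfl, inner_sub_right] at h
      rw [hsym, inner_add_left, h]
      ring
    refine ⟨fun y hy => ?_, fun x y hxy => ?_⟩
    · exact ⟨_, (key ⟨y, hy⟩).symm⟩
    · rw [invSubOne_apply T hT _ y (hxy ▸ key x)]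
      exact eq_sub_of_add_eq (by rw [← hxy, ← key x])
  · refine LinearPMap.IsFormalAdjoint.le_adjoint hd ?_
    rintro ⟨_, x, rfl⟩ ⟨_, y, rfl⟩
    rw [invSubOne_apply T hT x _ rfl, invSubOne_apply T hT y _ rfl]
    simp only [ContinuousLinearMap.coe_coe, inner_sub_left, map_sub, inner_sub_right, hsym]

/-- If a bounded self-adjoint operator `R` inverts `A + 1`, then `A` is essentially self-adjoint
if and only if the range of `A + 1` has trivial orthogonal complement. -/
theorem isEssentiallySelfAdjoint_iff [CompleteSpace H] {A : H →ₗ.[ℂ] H}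
    (hA : Dense (A.domain : Set H))
    (R : H →L[ℂ] H) (hR : IsSelfAdjoint R) (hRA : ∀ u : A.domain, R (u + A u) = u) :
    IsEssentiallySelfAdjoint A ↔ ∀ k : H, (∀ u : A.domain, inner ℂ k (u + A u) = 0) → k = 0 := by
  have hsym : ∀ T : H →L[ℂ] H, IsSelfAdjoint T → ∀ x y, inner ℂ (T x) y = inner ℂ x (T y) :=
    fun T hs x y => by rw [← ContinuousLinearMap.adjoint_inner_right, hs.adjoint_eq]
  have hinj : ∀ T : H →L[ℂ] H, IsSelfAdjoint T → (∀ u : A.domain, T (u + A u) = u) →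
      Function.Injective T := by
    intro T hs hTA
    rw [injective_iff_map_eq_zero]
    intro x hx
    refine hA.eq_zero_of_inner_left ℂ fun v hv => ?_
    have := hTA ⟨v, hv⟩
    rw [← show _ = v from this, ← hsym T hs, hx, inner_zero_left]
  have hext : ∀ (T : H →L[ℂ] H) (hs : IsSelfAdjoint T) (hTA : ∀ u : A.domain, T (u + A u) = u),
      A ≤ invSubOne T (hinj T hs hTA) := by
    intro T hs hTA
    refine ⟨fun u hu => ?_, fun u v huv => ?_⟩
    · rw [← show _ = u from hTA ⟨u, hu⟩]; exact mem_invSubOne_domain _ _ _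
    · rw [invSubOne_apply T _ (u + A u) v (by rw [← huv, hTA]), hTA, add_sub_cancel_left]
  have hsA : A.IsFormalAdjoint A := by
    intro u v
    have h := hsym R hR (u + A u) (v + A v)
    rw [hRA, hRA, inner_add_left, inner_add_right] at h
    exact (add_left_cancel h).symm
  constructor
  · rintro ⟨-, -, huniq⟩ k hk
    -- The rank-one term vanishes on the range of A + 1, so `P` inverts A + 1 as well and yields
    -- another self-adjoint extension.
    set P : H →L[ℂ] H := R + (InnerProductSpace.rankOne ℂ k k) with hP
    have hPs : IsSelfAdjoint P := hR.add (by
      rw [ContinuousLinearMap.isSelfAdjoint_iff', InnerProductSpace.adjoint_rankOne])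
    have hPA : ∀ u : A.domain, P (u + A u) = u := by
      intro u
      simp [hP, hRA, InnerProductSpace.rankOne_apply, hk]
    have heq := huniq.unique ⟨hext R hR hRA, isSelfAdjoint_invSubOne R (hinj R hR hRA) hR⟩
      ⟨hext P hPs hPA, isSelfAdjoint_invSubOne P (hinj P hPs hPA) hPs⟩
    -- Write R k = P y. Equality of the two extensions at this vector gives k - R k = y - P y, so y
    -- = k and ⟨k, k⟩ k = 0.
    have hmem : R k ∈ (invSubOne P (hinj P hPs hPA)).domain :=
      heq ▸ mem_invSubOne_domain R (hinj R hR hRA) k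
    obtain ⟨y, hy⟩ := hmem
    have h1 := invSubOne_apply R (hinj R hR hRA) k ⟨R k, mem_invSubOne_domain _ _ _⟩ rfl
    have h2 := invSubOne_apply P (hinj P hPs hPA) y ⟨R k, ⟨y, hy⟩⟩ hy.symm
    have h3 : invSubOne R (hinj R hR hRA) ⟨R k, mem_invSubOne_domain _ _ _⟩ =
        invSubOne P (hinj P hPs hPA) ⟨R k, ⟨y, hy⟩⟩ := heq.le.2 rfl
    rw [h1, h2] at h3
    have hy' : P y = R k := hy
    rw [hy', sub_left_inj] at h3
    subst h3
    have h4 : (inner ℂ k k : ℂ) • k = 0 := by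
      have : R k + (inner ℂ k k : ℂ) • k = R k := by
        simpa [hP, InnerProductSpace.rankOne_apply] using hy'
      simpa using this
    rcases smul_eq_zero.1 h4 with h | h
    · exact inner_self_eq_zero.1 h
    · exact h
  · intro hK
    refine ⟨hA, hsA, invSubOne R (hinj R hR hRA), ⟨hext R hR hRA, isSelfAdjoint_invSubOne _ _ hR⟩,
      ?_⟩
    rintro B ⟨hAB, hB⟩
    have hdense :
        Dense ((LinearMap.range (A.domain.subtype + A.toFun) : Submodule ℂ H) : Set H) := by
      rw [Submodule.dense_iff_topologicalClosure_eq_top,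
        Submodule.topologicalClosure_eq_top_iff, Submodule.eq_bot_iff]
      intro y hy
      rw [Submodule.mem_orthogonal'] at hy
      exact hK y fun u => hy _ ⟨u, rfl⟩
    -- The inclusion holds on the dense range of A + 1 and passes to all x because the graph of a
    -- self-adjoint operator is closed.
    have hgr : ∀ x, (R x, x - R x) ∈ (B.graph : Set (H × H)) := by
      intro x
      have hcl : IsClosed {x | (R x, x - R x) ∈ (B.graph : Set (H × H))} :=
        IsClosed.preimage (by fun_prop) hB.isClosed
      refine hcl.closure_subset_iff.2 ?_ (hdense x)
      rintro _ ⟨u, rfl⟩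
      simp only [LinearMap.add_apply, Submodule.subtype_apply, LinearPMap.toFun_eq_coe,
        Set.mem_ofPred_eq, hRA, add_sub_cancel_left]
      exact LinearPMap.le_graph_of_le hAB (A.mem_graph u)
    have hBf : B.IsFormalAdjoint B := by
      have := LinearPMap.adjoint_isFormalAdjoint hB.dense_domain
      rwa [LinearPMap.isSelfAdjoint_def.1 hB] at this
    have hle : invSubOne R (hinj R hR hRA) ≤ B := by
      refine ⟨?_, ?_⟩
      · rintro _ ⟨x, rfl⟩
        exact LinearPMap.mem_domain_of_mem_graph (hgr x)
      · rintro ⟨_, x, rfl⟩ y hxy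
        rw [invSubOne_apply R _ x _ rfl]
        obtain ⟨z, hz1, hz2⟩ := (LinearPMap.mem_graph_iff _).1 (hgr x)
        obtain rfl : z = y := Subtype.ext (hz1.trans hxy)
        exact hz2.symm
    -- A self-adjoint operator has no proper symmetric extension.
    refine le_antisymm ?_ hle
    rw [← LinearPMap.isSelfAdjoint_def.1 (isSelfAdjoint_invSubOne R (hinj R hR hRA) hR)]
    refine LinearPMap.IsFormalAdjoint.le_adjoint
      (isSelfAdjoint_invSubOne R (hinj R hR hRA) hR).dense_domain ?_
    intro x y
    rw [hle.2 (y := ⟨x, hle.1 x.2⟩) rfl]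
    exact hBf _ y

end EssentialSelfAdjointness

open scoped SchwartzMap LineDeriv

namespace FractionalLaplacian

variable {d : ℕ}

/-! ### Bounded real multiplication operators on L² -/

section Multiplication

/-- Multiplication by a bounded measurable real function as an operator on `L²`. -/
noncomputable def mulCLM (g : EuclideanSpace ℝ (Fin d) → ℝ) (hg : Measurable g) (C : ℝ)
    (hC : ∀ ξ, ‖g ξ‖ ≤ C) : L2 d →L[ℂ] L2 d :=
  have hm :  ∀ f : L2 d, MemLp (fun ξ => g ξ • f ξ) 2 volume := fun f =>
    MemLp.of_le_mul (g := f) (c := C) (Lp.memLp f)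
      (hg.aestronglyMeasurable.smul (Lp.aestronglyMeasurable f))
      (Filter.Eventually.of_forall fun ξ => by
        rw [norm_smul]; exact mul_le_mul_of_nonneg_right (hC ξ) (norm_nonneg _))
  LinearMap.mkContinuous
    { toFun := fun f => (hm f).toLp
      map_add' := fun f h => by
        rw [← MemLp.toLp_add]
        apply MemLp.toLp_congr
        filter_upwards [Lp.coeFn_add f h] with ξ hξ
        simp only [hξ, Pi.add_apply, smul_add]
      map_smul' := fun c f => by
        rw [RingHom.id_apply, ← MemLp.toLp_const_smul]
        apply MemLp.toLp_congr
        filter_upwards [Lp.coeFn_smul c f] with ξ hξ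
        simp only [hξ, Pi.smul_apply, smul_comm c] } C
    (fun f => by
      refine Lp.norm_le_mul_norm_of_ae_le_mul ?_
      filter_upwards [(hm f).coeFn_toLp] with ξ hξ
      change ‖((hm f).toLp) ξ‖ ≤ _
      rw [hξ, norm_smul]
      exact mul_le_mul_of_nonneg_right (hC ξ) (norm_nonneg _))

variable {g : EuclideanSpace ℝ (Fin d) → ℝ} {hg : Measurable g} {C : ℝ} {hC : ∀ ξ, ‖g ξ‖ ≤ C}

theorem coeFn_mulCLM (f : L2 d) : mulCLM g hg C hC f =ᵐ[volume] fun ξ => g ξ • f ξ :=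
  MemLp.coeFn_toLp (MemLp.of_le_mul (g := f) (c := C) (Lp.memLp f)
    (hg.aestronglyMeasurable.smul (Lp.aestronglyMeasurable f))
    (Filter.Eventually.of_forall fun ξ => by
      rw [Pi.smul_apply', norm_smul]
      exact mul_le_mul_of_nonneg_right (hC ξ) (norm_nonneg _)))

theorem inner_mulCLM_left (f h : L2 d) :
    inner ℂ (mulCLM g hg C hC f) h = inner ℂ f (mulCLM g hg C hC h) := by
  rw [L2.inner_def, L2.inner_def]
  apply integral_congr_ae
  filter_upwards [coeFn_mulCLM (hg := hg) (hC := hC) f, coeFn_mulCLM (hg := hg) (hC := hC) h]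
    with ξ h1 h2
  rw [h1, h2, inner_smul_left_eq_smul, inner_smul_right_eq_smul]

theorem mulCLM_mulCLM_cancel {g' : EuclideanSpace ℝ (Fin d) → ℝ} {hg' : Measurable g'} {C' : ℝ}
    {hC' : ∀ ξ, ‖g' ξ‖ ≤ C'} (h : ∀ ξ, g ξ * g' ξ = 1) (f : L2 d) :
    mulCLM g hg C hC (mulCLM g' hg' C' hC' f) = f := by
  apply Lp.ext
  filter_upwards [coeFn_mulCLM (hg := hg) (hC := hC) (mulCLM g' hg' C' hC' f),
    coeFn_mulCLM (hg := hg') (hC := hC') f] with ξ h1 h2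
  rw [h1, h2, smul_smul, h, one_smul]

end Multiplication

/-! ### Comparison of 1 + |ξ|^α with (1 + |ξ|²)^{α/2} -/

section Weight

/-- The weight `1 + |2πξ|²`, the symbol of `1 - Δ`. -/
noncomputable def weight (ξ : EuclideanSpace ℝ (Fin d)) : ℝ := 1 + (2 * Real.pi * ‖ξ‖) ^ 2

theorem one_le_weight (ξ : EuclideanSpace ℝ (Fin d)) : 1 ≤ weight ξ :=
  le_add_of_nonneg_right (by positivity)

theorem weight_pos (ξ : EuclideanSpace ℝ (Fin d)) : 0 < weight ξ :=
  one_pos.trans_le (one_le_weight ξ)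

@[fun_prop]
theorem measurable_weight : Measurable (weight (d := d)) := by unfold weight; fun_prop

@[fun_prop]
theorem measurable_symbol (α : ℝ) : Measurable (symbol (d := d) α) := by unfold symbol; fun_prop

theorem symbol_nonneg (α : ℝ) (ξ : EuclideanSpace ℝ (Fin d)) : 0 ≤ symbol α ξ := by
  unfold symbol; positivity

theorem hasTemperateGrowth_weight_rpow (s : ℝ) :
    (fun ξ : EuclideanSpace ℝ (Fin d) => weight ξ ^ s).HasTemperateGrowth := by
  have h1 := Function.hasTemperateGrowth_one_add_norm_sq_rpow (EuclideanSpace ℝ (Fin d)) s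
  have h2 : (fun ξ : EuclideanSpace ℝ (Fin d) => (2 * Real.pi) • ξ).HasTemperateGrowth := by
    fun_prop
  have h3 : (fun ξ : EuclideanSpace ℝ (Fin d) => weight ξ ^ s) =
      (fun ξ : EuclideanSpace ℝ (Fin d) => (1 + ‖ξ‖ ^ 2) ^ s) ∘ fun ξ => (2 * Real.pi) • ξ := by
    ext ξ
    simp [weight, norm_smul, abs_of_pos Real.pi_pos]
  rw [h3]
  exact h1.comp h2

theorem symbol_le_weight_rpow {α : ℝ} (hα : 0 < α) (ξ : EuclideanSpace ℝ (Fin d)) :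
    symbol α ξ ≤ weight ξ ^ (α / 2) := by
  have : symbol α ξ = ((2 * Real.pi * ‖ξ‖) ^ 2) ^ (α / 2) := by
    rw [symbol, ← Real.rpow_natCast, ← Real.rpow_mul (by positivity)]; congr 1; push_cast; ring
  rw [this]
  exact Real.rpow_le_rpow (by positivity) (by simp [weight]) (by positivity)

theorem weight_rpow_le_symbol {α : ℝ} (hα : 0 < α) (ξ : EuclideanSpace ℝ (Fin d)) :
    weight ξ ^ (α / 2) ≤ 2 ^ (α / 2) * (1 + symbol α ξ) := by
  have : symbol α ξ = ((2 * Real.pi * ‖ξ‖) ^ 2) ^ (α / 2) := by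
    rw [symbol, ← Real.rpow_natCast, ← Real.rpow_mul (by positivity)]; congr 1; push_cast; ring
  rw [this]
  set s := (2 * Real.pi * ‖ξ‖) ^ 2 with hs
  have hs0 : 0 ≤ s := by positivity
  have hw : weight ξ ≤ 2 * max 1 s := by
    rw [two_mul]; exact add_le_add (le_max_left 1 s) (le_max_right 1 s)
  calc weight ξ ^ (α / 2) ≤ (2 * max 1 s) ^ (α / 2) :=
        Real.rpow_le_rpow (weight_pos ξ).le hw (by positivity)
    _ = 2 ^ (α / 2) * (max 1 s) ^ (α / 2) := Real.mul_rpow (by positivity) (by positivity)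
    _ ≤ _ := by
        gcongr
        rcases le_total 1 s with h | h
        · rw [max_eq_right h]; linarith
        · rw [max_eq_left h, Real.one_rpow]; linarith [Real.rpow_nonneg hs0 (α / 2)]

end Weight

/-! ### Powers of 1 - Δ on the Schwartz space -/

section Bessel

theorem fourier_fourierMultiplierCLM_apply {g : EuclideanSpace ℝ (Fin d) → ℝ}
    (hg : g.HasTemperateGrowth) (f : 𝓢(EuclideanSpace ℝ (Fin d), ℂ))
    (ξ : EuclideanSpace ℝ (Fin d)) :
    𝓕 (SchwartzMap.fourierMultiplierCLM ℂ g f) ξ = g ξ • 𝓕 f ξ := by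
  rw [SchwartzMap.fourierMultiplierCLM_apply, FourierTransform.fourier_fourierInv_eq,
    SchwartzMap.smulLeftCLM_apply_apply hg]

/-- The operator `(1 - Δ)^s` on Schwartz functions. -/
noncomputable def besselOp (s : ℝ) :
    𝓢(EuclideanSpace ℝ (Fin d), ℂ) →L[ℝ] 𝓢(EuclideanSpace ℝ (Fin d), ℂ) :=
  SchwartzMap.fourierMultiplierCLM ℂ fun ξ => weight ξ ^ s

theorem fourier_besselOp_apply (s : ℝ) (f : 𝓢(EuclideanSpace ℝ (Fin d), ℂ))
    (ξ : EuclideanSpace ℝ (Fin d)) : 𝓕 (besselOp s f) ξ = weight ξ ^ s • 𝓕 f ξ :=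
  fourier_fourierMultiplierCLM_apply (hasTemperateGrowth_weight_rpow s) f ξ

theorem fourier_ext {f g : 𝓢(EuclideanSpace ℝ (Fin d), ℂ)} (h : ∀ ξ, 𝓕 f ξ = 𝓕 g ξ) : f = g := by
  have : (𝓕 f : 𝓢(EuclideanSpace ℝ (Fin d), ℂ)) = 𝓕 g := SchwartzMap.ext h
  simpa [FourierTransform.fourierInv_fourier_eq] using
    congrArg (fun h : 𝓢(EuclideanSpace ℝ (Fin d), ℂ) =>
      (𝓕⁻ h : 𝓢(EuclideanSpace ℝ (Fin d), ℂ))) this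

theorem besselOp_besselOp (s t : ℝ) (f : 𝓢(EuclideanSpace ℝ (Fin d), ℂ)) :
    besselOp s (besselOp t f) = besselOp (s + t) f := fourier_ext fun ξ => by
  rw [fourier_besselOp_apply, fourier_besselOp_apply, fourier_besselOp_apply, smul_smul,
    Real.rpow_add (weight_pos ξ)]

theorem besselOp_zero (f : 𝓢(EuclideanSpace ℝ (Fin d), ℂ)) : besselOp 0 f = f :=
  fourier_ext fun ξ => by rw [fourier_besselOp_apply, Real.rpow_zero, one_smul]

end Bessel

/-! ### Reduction to density of (1 - Δ)^{α/2} C₀^∞(N) -/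

section Reduction

theorem mem_testFunctions_iff {S : Set (EuclideanSpace ℝ (Fin d))} {u : L2 d} :
    u ∈ testFunctions S ↔ ∃ φ : 𝓢(EuclideanSpace ℝ (Fin d), ℂ), HasCompactSupport φ ∧
      tsupport φ ⊆ Sᶜ ∧ u = φ.toLp 2 := by
  constructor
  · rintro ⟨φ, h1, h2, h3, h4⟩
    refine ⟨h2.toSchwartzMap h1, h2, h3, Lp.ext ?_⟩
    filter_upwards [h4, (h2.toSchwartzMap h1).coeFn_toLp 2 volume] with x hx hx'
    rw [hx, hx']; rfl
  · rintro ⟨φ, h1, h2, rfl⟩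
    exact ⟨φ, φ.smooth ⊤, h1, h2, φ.coeFn_toLp 2 volume⟩

/-- By the fundamental lemma of the calculus of variations, a function orthogonal to all test
functions vanishes almost everywhere on the open complement of `S`; the null set `S` does not matter
in L². -/
theorem dense_testFunctions {S : Set (EuclideanSpace ℝ (Fin d))} (hS : IsClosed S)
    (hS0 : volume S = 0) : Dense (testFunctions S : Set (L2 d)) := by
  rw [Submodule.dense_iff_topologicalClosure_eq_top,
    Submodule.topologicalClosure_eq_top_iff, Submodule.eq_bot_iff]
  intro f hf
  rw [Submodule.mem_orthogonal] at hf
  have hloc : LocallyIntegrable (f : EuclideanSpace ℝ (Fin d) → ℂ) volume :=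
    (Lp.memLp f).locallyIntegrable (by norm_num)
  have h0 := hS.isOpen_compl.ae_eq_zero_of_integral_contDiff_smul_eq_zero
    (hloc.locallyIntegrableOn _) (fun g hg hgc hgS => by
      have hg' : ContDiff ℝ ∞ (fun x => (g x : ℂ)) := Complex.ofRealCLM.contDiff.comp hg
      have hgc' : HasCompactSupport (fun x => (g x : ℂ)) :=
        hgc.comp_left (g := Complex.ofReal) Complex.ofReal_zero
      set φ := hgc'.toSchwartzMap hg' with hφ
      have hφg : ∀ x, φ x = (g x : ℂ) := fun x => rfl
      have hsub : tsupport φ ⊆ Sᶜ := by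
        refine subset_trans (closure_mono fun x hx => ?_) hgS
        simpa [hφg] using hx
      have h1 := hf _ (mem_testFunctions_iff.2 ⟨φ, hgc', hsub, rfl⟩)
      rw [L2.inner_def] at h1
      rw [← h1]
      apply integral_congr_ae
      filter_upwards [φ.coeFn_toLp 2 volume] with x hx
      rw [hx, hφg]
      simp [RCLike.inner_apply, mul_comm])
  apply Lp.ext
  filter_upwards [h0, measure_eq_zero_iff_ae_notMem.1 hS0, Lp.coeFn_zero ℂ 2
    (volume : Measure (EuclideanSpace ℝ (Fin d)))] with x h1 h2 h3
  rw [h1 h2, h3]; rfl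

theorem fourier_add_fracLaplacian {α : ℝ} (hα : 0 < α) {S : Set (EuclideanSpace ℝ (Fin d))}
    (u : (fracLaplacian hα S).domain) :
    (𝓕 ((u : L2 d) + fracLaplacian hα S u) : L2 d) =ᵐ[volume]
      fun ξ => (1 + symbol α ξ) • (𝓕 (u : L2 d) : L2 d) ξ := by
  have h : (𝓕 (fracLaplacian hα S u) : L2 d) = (memLp_symbol_smul_fourier hα u.2).toLp :=
    FourierTransform.fourier_fourierInv_eq _
  rw [FourierTransform.fourier_add, h]
  filter_upwards [Lp.coeFn_add (𝓕 (u : L2 d) : L2 d) (memLp_symbol_smul_fourier hα u.2).toLp,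
    (memLp_symbol_smul_fourier hα u.2).coeFn_toLp] with ξ h1 h2
  rw [h1, Pi.add_apply, h2, add_smul, one_smul]

set_option maxHeartbeats 800000 in
/-- Essential self-adjointness of `(-Δ)^{α/2}` on `C₀^∞(ℝᵈ ∖ S)` means that
`(1 - Δ)^{α/2} C₀^∞(ℝᵈ ∖ S)` is dense. -/
theorem isEssentiallySelfAdjoint_fracLaplacian_iff {α : ℝ} (hα : 0 < α)
    {S : Set (EuclideanSpace ℝ (Fin d))} (hS : IsClosed S) (hS0 : volume S = 0) :
    IsEssentiallySelfAdjoint (fracLaplacian hα S) ↔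
      ∀ k : L2 d, (∀ φ : 𝓢(EuclideanSpace ℝ (Fin d), ℂ), HasCompactSupport φ →
        tsupport φ ⊆ Sᶜ → inner ℂ k ((besselOp (α / 2) φ).toLp 2) = 0) → k = 0 := by
  have hs1 : ∀ ξ : EuclideanSpace ℝ (Fin d), 0 < 1 + symbol α ξ := fun ξ => by
    linarith [symbol_nonneg α ξ]
  have hw1 : ∀ ξ : EuclideanSpace ℝ (Fin d), 0 < weight ξ ^ (α / 2) := fun ξ =>
    Real.rpow_pos_of_pos (weight_pos ξ) _
  set r : EuclideanSpace ℝ (Fin d) → ℝ := fun ξ => (1 + symbol α ξ)⁻¹ with hr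
  -- On the Fourier side A + 1 is (1 - Δ)^{α/2} followed by multiplication by `q`. Both `q` and its
  -- reciprocal `q'` are bounded, so they carry the orthogonal complements of the two ranges into
  -- each other.
  set q : EuclideanSpace ℝ (Fin d) → ℝ := fun ξ => (1 + symbol α ξ) / weight ξ ^ (α / 2) with hq
  set q' : EuclideanSpace ℝ (Fin d) → ℝ := fun ξ => weight ξ ^ (α / 2) / (1 + symbol α ξ) with hq'
  have hrm : Measurable r := by fun_prop
  have hqm : Measurable q := by fun_prop
  have hqm' : Measurable q' := by fun_prop
  have hrC : ∀ ξ, ‖r ξ‖ ≤ 1 := fun ξ => by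
    rw [Real.norm_of_nonneg (inv_nonneg.2 (hs1 ξ).le)]
    exact inv_le_one_of_one_le₀ (by linarith [symbol_nonneg α ξ])
  have hqC : ∀ ξ, ‖q ξ‖ ≤ 2 := fun ξ => by
    rw [Real.norm_of_nonneg (div_nonneg (hs1 ξ).le (hw1 ξ).le), div_le_iff₀ (hw1 ξ)]
    linarith [symbol_le_weight_rpow hα ξ, Real.one_le_rpow (one_le_weight ξ)
      (by positivity : 0 ≤ α / 2)]
  have hqC' : ∀ ξ, ‖q' ξ‖ ≤ 2 ^ (α / 2) := fun ξ => by
    rw [Real.norm_of_nonneg (div_nonneg (hw1 ξ).le (hs1 ξ).le), div_le_iff₀ (hs1 ξ)]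
    exact weight_rpow_le_symbol hα ξ
  let F : L2 d ≃ₗᵢ[ℂ] L2 d := Lp.fourierTransformₗᵢ (EuclideanSpace ℝ (Fin d)) ℂ
  have hF : ∀ f : L2 d, F f = 𝓕 f := fun f => rfl
  let R : L2 d →L[ℂ] L2 d := (F.symm : L2 d →L[ℂ] L2 d) ∘L mulCLM r hrm 1 hrC ∘L
    (F : L2 d →L[ℂ] L2 d)
  have hRapp : ∀ f, R f = F.symm (mulCLM r hrm 1 hrC (F f)) := fun f => rfl
  have hR : IsSelfAdjoint R := by
    rw [ContinuousLinearMap.isSelfAdjoint_iff_isSymmetric]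
    intro f h
    change inner ℂ (R f) h = inner ℂ f (R h)
    rw [hRapp, hRapp, ← F.inner_map_map, F.apply_symm_apply, inner_mulCLM_left,
      ← F.inner_map_map f, F.apply_symm_apply]
  have hRA : ∀ u : (fracLaplacian hα S).domain, R ((u : L2 d) + fracLaplacian hα S u) = u := by
    intro u
    rw [hRapp, F.symm_apply_eq]
    apply Lp.ext
    filter_upwards [coeFn_mulCLM (hg := hrm) (hC := hrC) (F ((u : L2 d) + fracLaplacian hα S u)),
      fourier_add_fracLaplacian hα u] with ξ h1 h2
    rw [h1, hF, h2, smul_smul, inv_mul_cancel₀ (hs1 ξ).ne', one_smul, hF]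
  have key : ∀ (u : (fracLaplacian hα S).domain) (φ : 𝓢(EuclideanSpace ℝ (Fin d), ℂ)),
      (u : L2 d) = φ.toLp 2 → F ((u : L2 d) + fracLaplacian hα S u) =
        mulCLM q hqm 2 hqC (F ((besselOp (α / 2) φ).toLp 2)) := by
    intro u φ hu
    apply Lp.ext
    have h3 : F ((besselOp (α / 2) φ).toLp 2) = (𝓕 (besselOp (α / 2) φ)).toLp 2 :=
      SchwartzMap.toLp_fourier_eq _
    have h4 : (𝓕 (u : L2 d) : L2 d) = (𝓕 φ).toLp 2 := by
      rw [hu]; exact SchwartzMap.toLp_fourier_eq _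
    rw [h3, hF]
    filter_upwards [coeFn_mulCLM (hg := hqm) (hC := hqC) ((𝓕 (besselOp (α / 2) φ)).toLp 2),
      fourier_add_fracLaplacian hα u, (𝓕 (besselOp (α / 2) φ)).coeFn_toLp 2 volume,
      (𝓕 φ).coeFn_toLp 2 volume] with ξ h5 h6 h7 h8
    rw [h5, h6, h7, h4, h8, fourier_besselOp_apply, smul_smul, hq, div_mul_cancel₀ _ (hw1 ξ).ne']
  have hqq' : ∀ ξ, q ξ * q' ξ = 1 := fun ξ => by
    have := (hs1 ξ).ne'
    have := (hw1 ξ).ne'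
    simp only [hq, hq']; field_simp
  rw [isEssentiallySelfAdjoint_iff (A := fracLaplacian hα S) (dense_testFunctions hS hS0) R hR hRA]
  constructor
  · intro H k hk
    have h0 : F.symm (mulCLM q' hqm' _ hqC' (F k)) = 0 := by
      refine H _ fun u => ?_
      obtain ⟨φ, h1, h2, h3⟩ := mem_testFunctions_iff.1 u.2
      rw [← F.inner_map_map, F.apply_symm_apply, key u φ h3, ← inner_mulCLM_left,
        mulCLM_mulCLM_cancel hqq', F.inner_map_map]
      exact hk φ h1 h2
    have h1 : mulCLM q' hqm' _ hqC' (F k) = 0 := by simpa using h0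
    have h2 := mulCLM_mulCLM_cancel (hg := hqm) (hC := hqC) (hg' := hqm') (hC' := hqC') hqq' (F k)
    rw [h1, map_zero] at h2
    simpa using h2.symm
  · intro H g hg
    have h0 : F.symm (mulCLM q hqm _ hqC (F g)) = 0 := by
      refine H _ fun φ h1 h2 => ?_
      obtain ⟨u, hu⟩ : ∃ u : (fracLaplacian hα S).domain, (u : L2 d) = φ.toLp 2 :=
        ⟨⟨φ.toLp 2, mem_testFunctions_iff.2 ⟨φ, h1, h2, rfl⟩⟩, rfl⟩
      rw [← F.inner_map_map, F.apply_symm_apply, inner_mulCLM_left, ← key u φ hu, F.inner_map_map]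
      exact hg u
    have h1 : mulCLM q hqm _ hqC (F g) = 0 := by simpa using h0
    have h2 := mulCLM_mulCLM_cancel (hg := hqm') (hC := hqC') (hg' := hqm) (hC' := hqC)
      (fun ξ => by rw [mul_comm, hqq']) (F g)
    rw [h1, map_zero] at h2
    simpa using h2.symm

end Reduction

/-! ### Multipliers as convolutions, and preservation of positivity -/

section Kernel

open Real in
/-- A Fourier multiplier whose symbol is the Fourier transform of an integrable function acts by
convolution with that function. -/
theorem fourierMultiplierCLM_eq_integral {κ : EuclideanSpace ℝ (Fin d) → ℂ} (hκ : Integrable κ)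
    {m : EuclideanSpace ℝ (Fin d) → ℝ} (hm : m.HasTemperateGrowth)
    (hκm : ∀ ξ, 𝓕 κ ξ = (m ξ : ℂ)) (f : 𝓢(EuclideanSpace ℝ (Fin d), ℂ))
    (x : EuclideanSpace ℝ (Fin d)) :
    SchwartzMap.fourierMultiplierCLM ℂ m f x = ∫ y, κ (x - y) * f y := by
  set G : EuclideanSpace ℝ (Fin d) → ℂ := fun ξ => 𝐞 (inner ℝ ξ x) • (𝓕 f : 𝓢(_, ℂ)) ξ with hG
  have hGi : Integrable G := by
    refine (SchwartzMap.integrable (𝓕 f)).mono ?_ (Filter.Eventually.of_forall fun ξ => ?_)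
    · refine Continuous.aestronglyMeasurable ?_
      exact (by fun_prop : Continuous fun ξ => 𝐞 (inner ℝ ξ x)).smul (SchwartzMap.continuous _)
    · simp [hG, Circle.norm_smul]
  -- The identity ∫ κ̂ G = ∫ κ Ĝ is used with `G` the modulated transform of `f`, so that Ĝ(y) = f(x
  -- - y).
  have h1 := VectorFourier.integral_fourierIntegral_smul_eq_flip (μ := volume) (ν := volume)
    (L := innerₗ (EuclideanSpace ℝ (Fin d))) continuous_fourierChar continuous_inner hκ hGi
  have h2 : SchwartzMap.fourierMultiplierCLM ℂ m f x =
      ∫ ξ, 𝓕 κ ξ • G ξ := by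
    rw [SchwartzMap.fourierMultiplierCLM_apply, SchwartzMap.fourierInv_coe, Real.fourierInv_eq]
    congr 1 with ξ
    rw [SchwartzMap.smulLeftCLM_apply_apply hm, hκm, hG]
    simp only [Circle.smul_def, smul_eq_mul, Complex.real_smul]
    ring
  have h3 : ∀ y, 𝓕 G y = f (x - y) := by
    intro y
    rw [Real.fourier_eq]
    have h4 : f (x - y) = 𝓕⁻ (𝓕 f : 𝓢(EuclideanSpace ℝ (Fin d), ℂ)) (x - y) := by
      rw [FourierTransform.fourierInv_fourier_eq]
    rw [h4, SchwartzMap.fourierInv_coe, Real.fourierInv_eq]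
    congr 1 with ξ
    rw [hG]
    simp only [smul_smul]
    rw [← AddChar.map_add_eq_mul, inner_sub_right]
    congr 2
    ring
  rw [h2]
  refine h1.trans ?_
  rw [← integral_sub_left_eq_self _ volume x]
  congr 1 with y
  rw [smul_eq_mul]
  congr 1
  have : f y = f (x - (x - y)) := by rw [sub_sub_cancel]
  rw [this, ← h3]
  simp only [Real.fourier_eq, VectorFourier.fourierIntegral, LinearMap.flip_apply,
    innerₗ_apply_apply,
    real_inner_comm]

/-- The complexification of a real Schwartz function. -/
noncomputable def complexify (r : 𝓢(EuclideanSpace ℝ (Fin d), ℝ)) :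
    𝓢(EuclideanSpace ℝ (Fin d), ℂ) := SchwartzMap.postcompCLM Complex.ofRealCLM r

@[simp]
theorem complexify_apply (r : 𝓢(EuclideanSpace ℝ (Fin d), ℝ)) (x : EuclideanSpace ℝ (Fin d)) :
    complexify r x = (r x : ℂ) := rfl

/-- A Fourier multiplier with an integrable nonnegative kernel preserves nonnegativity. -/
theorem exists_complexify_eq_fourierMultiplierCLM {κ : EuclideanSpace ℝ (Fin d) → ℝ}
    (hκ : Integrable κ) (hκ0 : ∀ x, 0 ≤ κ x) {m : EuclideanSpace ℝ (Fin d) → ℝ}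
    (hm : m.HasTemperateGrowth) (hκm : ∀ ξ, 𝓕 (fun x => (κ x : ℂ)) ξ = (m ξ : ℂ))
    (r : 𝓢(EuclideanSpace ℝ (Fin d), ℝ)) (hr : ∀ x, 0 ≤ r x) :
    ∃ s : 𝓢(EuclideanSpace ℝ (Fin d), ℝ), (∀ x, 0 ≤ s x) ∧ (∀ x, s x = ∫ y, κ (x - y) * r y) ∧
      complexify s = SchwartzMap.fourierMultiplierCLM ℂ m (complexify r) := by
  have h : ∀ x, SchwartzMap.fourierMultiplierCLM ℂ m (complexify r) x =
      ((∫ y, κ (x - y) * r y : ℝ) : ℂ) := by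
    intro x
    rw [fourierMultiplierCLM_eq_integral hκ.ofReal hm hκm, ← integral_complex_ofReal]
    simp
  refine ⟨SchwartzMap.postcompCLM Complex.reCLM
    (SchwartzMap.fourierMultiplierCLM ℂ m (complexify r)), fun x => ?_, fun x => ?_, ?_⟩
  · rw [SchwartzMap.postcompCLM_apply, h, Complex.reCLM_apply, Complex.ofReal_re]
    exact integral_nonneg fun y => mul_nonneg (hκ0 _) (hr _)
  · rw [SchwartzMap.postcompCLM_apply, h, Complex.reCLM_apply, Complex.ofReal_re]
  · ext x
    rw [complexify_apply, SchwartzMap.postcompCLM_apply, h, Complex.reCLM_apply, Complex.ofReal_re]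

/-- All derivatives of x ↦ e^{-x} are bounded by 1 on the positive half-line, though not on ℝ. The
composition rule is therefore applied on `Set.Ioi 0`, where the function t · `weight` takes its
values. -/
theorem hasTemperateGrowth_exp_neg_weight {t : ℝ} (ht : 0 < t) :
    (fun ξ : EuclideanSpace ℝ (Fin d) => Real.exp (-(t * weight ξ))).HasTemperateGrowth := by
  have hw : (fun ξ : EuclideanSpace ℝ (Fin d) => t * weight ξ).HasTemperateGrowth := by
    have := hasTemperateGrowth_weight_rpow (d := d) 1
    simp only [Real.rpow_one] at this
    exact (Function.HasTemperateGrowth.const t).mul this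
  have hd : ContDiff ℝ ∞ (fun x : ℝ => Real.exp (-x)) := by fun_prop
  refine Function.HasTemperateGrowth.comp' (g := fun x : ℝ => Real.exp (-x)) (t := Set.Ioi 0)
    ?_ isOpen_Ioi.uniqueDiffOn hd.contDiffOn ?_ hw
  · rintro _ ⟨ξ, rfl⟩
    exact mul_pos ht (weight_pos ξ)
  · intro N
    refine ⟨0, 1, zero_le_one, fun n _ x hx => ?_⟩
    rw [norm_iteratedFDerivWithin_eq_norm_iteratedDerivWithin,
      iteratedDerivWithin_eq_iteratedDeriv isOpen_Ioi.uniqueDiffOn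
        (hd.contDiffAt.of_le (mod_cast le_top)) hx, iteratedDeriv_comp_neg n Real.exp x,
      iteratedDeriv_eq_iterate, Real.iter_deriv_exp]
    have : Real.exp (-x) ≤ 1 := Real.exp_le_one_iff.2 (by simpa using hx.le)
    simpa using this

theorem measurable_besselKernel (α : ℝ) :
    Measurable (besselKernel α : EuclideanSpace ℝ (Fin d) → ℝ≥0∞) :=
  Measurable.lintegral_prod_right'
    (((measurable_besselDensity α).comp measurable_swap).ennreal_ofReal)

theorem integrable_toReal_besselKernel {α : ℝ} (hα : 0 < α) :
    Integrable (fun x : EuclideanSpace ℝ (Fin d) => (besselKernel α x).toReal) :=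
  integrable_toReal_of_lintegral_ne_top (measurable_besselKernel α).aemeasurable
    (by rw [lintegral_besselKernel hα]; simp)

/-- The heat operator `e^{-t(1 - Δ)}` preserves nonnegativity. -/
theorem exists_complexify_eq_heat {t : ℝ} (ht : 0 < t)
    (r : 𝓢(EuclideanSpace ℝ (Fin d), ℝ)) (hr : ∀ x, 0 ≤ r x) :
    ∃ s : 𝓢(EuclideanSpace ℝ (Fin d), ℝ), (∀ x, 0 ≤ s x) ∧
      ∀ ξ, 𝓕 (complexify s) ξ = Real.exp (-(t * weight ξ)) • 𝓕 (complexify r) ξ := by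
  -- With α = 2 the factor Γ(α/2)⁻¹ t^{α/2 - 1} equals 1, and the Bessel density is exactly the
  -- kernel of e^{-t(1 - Δ)}.
  obtain ⟨s, h1, -, h2⟩ := exists_complexify_eq_fourierMultiplierCLM
    (integrable_besselDensity (α := 2) ht) (fun x => besselDensity_nonneg two_pos ht x)
    (hasTemperateGrowth_exp_neg_weight ht) (fun ξ => by
      rw [Real.fourier_eq, fourier_besselDensity ht]
      norm_num [weight, mul_comm]) r hr
  refine ⟨s, h1, fun ξ => ?_⟩
  rw [h2, fourier_fourierMultiplierCLM_apply (hasTemperateGrowth_exp_neg_weight ht)]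

theorem fourier_besselKernel_eq_weight {α : ℝ} (hα : 0 < α) (ξ : EuclideanSpace ℝ (Fin d)) :
    𝓕 (fun x : EuclideanSpace ℝ (Fin d) => ((besselKernel α x).toReal : ℂ)) ξ =
      ((weight ξ ^ (-(α / 2)) : ℝ) : ℂ) := by
  rw [fourier_besselKernel hα, weight, neg_div]

theorem besselOp_eq_integral {α : ℝ} (hα : 0 < α) (f : 𝓢(EuclideanSpace ℝ (Fin d), ℂ))
    (x : EuclideanSpace ℝ (Fin d)) :
    besselOp (-(α / 2)) f x = ∫ y, ((besselKernel α (x - y)).toReal : ℂ) * f y :=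
  fourierMultiplierCLM_eq_integral (integrable_toReal_besselKernel hα).ofReal
    (hasTemperateGrowth_weight_rpow _) (fourier_besselKernel_eq_weight hα) f x

/-- The operator `(1 - Δ)^{-α/2}` preserves nonnegativity and acts by convolution with the Bessel
kernel. -/
theorem exists_complexify_eq_besselOp {α : ℝ} (hα : 0 < α)
    (r : 𝓢(EuclideanSpace ℝ (Fin d), ℝ)) (hr : ∀ x, 0 ≤ r x) :
    ∃ s : 𝓢(EuclideanSpace ℝ (Fin d), ℝ), (∀ x, 0 ≤ s x) ∧
      (∀ x, s x = ∫ y, (besselKernel α (x - y)).toReal * r y) ∧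
      complexify s = besselOp (-(α / 2)) (complexify r) :=
  exists_complexify_eq_fourierMultiplierCLM (integrable_toReal_besselKernel hα)
    (fun _ => ENNReal.toReal_nonneg) (hasTemperateGrowth_weight_rpow _)
    (fourier_besselKernel_eq_weight hα) r hr

/-- The kernel has finite integral, so its infinite values occupy a null set. This links the
extended-valued potential to ordinary convolution integrals. -/
theorem besselPotential_eq_lintegral_toReal {α : ℝ} (hα : 0 < α) (f : EuclideanSpace ℝ (Fin d) → ℝ)
    (x : EuclideanSpace ℝ (Fin d)) :
    besselPotential α f x =
      ∫⁻ y, ENNReal.ofReal ((besselKernel α (x - y)).toReal) * ENNReal.ofReal (f y) := by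
  have h : ∀ᵐ z : EuclideanSpace ℝ (Fin d), besselKernel α z < ⊤ :=
    ae_lt_top (measurable_besselKernel α) (by rw [lintegral_besselKernel hα]; simp)
  have h' : ∀ᵐ y : EuclideanSpace ℝ (Fin d), besselKernel α (x - y) < ⊤ :=
    (Measure.measurePreserving_sub_left volume x).quasiMeasurePreserving.ae h
  refine lintegral_congr_ae ?_
  filter_upwards [h'] with y hy
  rw [ENNReal.ofReal_toReal hy.ne]

end Kernel

/-! ### Density implies zero capacity -/

section CapacityOfDense

theorem besselOp_smul (s : ℝ) (c : ℂ) (f : 𝓢(EuclideanSpace ℝ (Fin d), ℂ)) :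
    besselOp s (c • f) = c • besselOp s f := fourier_ext fun ξ => by
  rw [fourier_besselOp_apply, FourierTransform.fourier_smul, FourierTransform.fourier_smul,
    _root_.smul_apply, _root_.smul_apply, fourier_besselOp_apply, smul_comm]

theorem toLp_sub (f g : 𝓢(EuclideanSpace ℝ (Fin d), ℂ)) :
    ((f - g).toLp 2 volume : L2 d) = f.toLp 2 volume - g.toLp 2 volume :=
  map_sub (SchwartzMap.toLpCLM ℂ ℂ 2 volume) f g

/-- The image `(1 - Δ)^s C₀^∞(ℝᵈ ∖ S)`. -/
noncomputable def besselTest (s : ℝ) (S : Set (EuclideanSpace ℝ (Fin d))) : Submodule ℂ (L2 d) where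
  carrier := {u | ∃ φ : 𝓢(EuclideanSpace ℝ (Fin d), ℂ), HasCompactSupport φ ∧
      tsupport φ ⊆ Sᶜ ∧ (besselOp s φ).toLp 2 = u}
  zero_mem' := ⟨0, HasCompactSupport.zero, by simp [tsupport], by
    rw [map_zero]; exact map_zero (SchwartzMap.toLpCLM ℂ ℂ 2 volume)⟩
  add_mem' := by
    rintro _ _ ⟨φ, h1, h2, rfl⟩ ⟨ψ, h3, h4, rfl⟩
    refine ⟨φ + ψ, h1.add h3, (tsupport_add φ ψ).trans (Set.union_subset h2 h4), ?_⟩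
    rw [map_add]; exact map_add (SchwartzMap.toLpCLM ℂ ℂ 2 volume) _ _
  smul_mem' := by
    rintro c _ ⟨φ, h1, h2, rfl⟩
    refine ⟨c • φ, h1.smul_left (f := fun _ => c),
      (closure_mono (Function.support_const_smul_subset c φ)).trans h2, ?_⟩
    rw [besselOp_smul]; exact map_smul (SchwartzMap.toLpCLM ℂ ℂ 2 volume) _ _

/-- If `ψ` has modulus at least one on `S`, then `|(1 - Δ)^{α/2} ψ|` is admissible for the capacity
of `S`. -/
theorem capacity_le_of_one_le_norm {α : ℝ} (hα : 0 < α) {S : Set (EuclideanSpace ℝ (Fin d))}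
    (ψ : 𝓢(EuclideanSpace ℝ (Fin d), ℂ)) (hψ : ∀ x ∈ S, 1 ≤ ‖ψ x‖) :
    capacity α S ≤ ENNReal.ofReal (‖((besselOp (α / 2) ψ).toLp 2 : L2 d)‖ ^ 2) := by
  set f := besselOp (α / 2) ψ with hf
  have hfm : MemLp (fun y => ‖f y‖) 2 volume := (f.memLp 2 volume).norm
  have hnorm : ‖hfm.toLp‖ = ‖(f.toLp 2 : L2 d)‖ := by
    rw [Lp.norm_toLp, SchwartzMap.norm_toLp, eLpNorm_norm]
  rw [← hnorm]
  refine iInf_le_of_le hfm.toLp (iInf_le_of_le ?_ (iInf_le_of_le ?_ le_rfl))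
  · rw [← Lp.coeFn_nonneg]
    filter_upwards [hfm.coeFn_toLp] with y hy
    rw [hy]; exact norm_nonneg _
  · intro x hx
    have h1 : ψ x = ∫ y, ((besselKernel α (x - y)).toReal : ℂ) * f y := by
      rw [← besselOp_eq_integral hα, hf, besselOp_besselOp, neg_add_cancel, besselOp_zero]
    have h2 : (1 : ℝ≥0∞) ≤ ‖ψ x‖ₑ := by
      rw [← ofReal_norm]; exact ENNReal.one_le_ofReal.2 (hψ x hx)
    refine h2.trans ?_
    rw [h1, besselPotential_eq_lintegral_toReal hα]
    refine (enorm_integral_le_lintegral_enorm _).trans (lintegral_mono_ae ?_)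
    filter_upwards [hfm.coeFn_toLp] with y hy
    rw [hy, enorm_mul, ofReal_norm, ← ofReal_norm, Complex.norm_real,
      Real.norm_of_nonneg ENNReal.toReal_nonneg]

/-- A cutoff equal to 1 on `S` can be corrected by test functions vanishing on `S` without changing
its values there, and by density the correction makes its (1 - Δ)^{α/2} image arbitrarily small. -/
theorem capacity_eq_zero_of_forall_inner {α : ℝ} (hα : 0 < α)
    {S : Set (EuclideanSpace ℝ (Fin d))} (hS : IsCompact S)
    (H : ∀ k : L2 d, (∀ φ : 𝓢(EuclideanSpace ℝ (Fin d), ℂ), HasCompactSupport φ →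
        tsupport φ ⊆ Sᶜ → inner ℂ k ((besselOp (α / 2) φ).toLp 2) = 0) → k = 0) :
    capacity α S = 0 := by
  obtain ⟨R, hR0, hR⟩ := hS.isBounded.subset_closedBall_lt 0 (0 : EuclideanSpace ℝ (Fin d))
  let b : ContDiffBump (0 : EuclideanSpace ℝ (Fin d)) := ⟨R, R + 1, hR0, by linarith⟩
  have hb' : ContDiff ℝ ∞ (fun x => (b x : ℂ)) := Complex.ofRealCLM.contDiff.comp b.contDiff
  have hbc : HasCompactSupport (fun x => (b x : ℂ)) :=
    b.hasCompactSupport.comp_left (g := Complex.ofReal) Complex.ofReal_zero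
  set χ := hbc.toSchwartzMap hb' with hχ
  have hχ1 : ∀ x ∈ S, χ x = 1 := fun x hx => by
    change (b x : ℂ) = 1
    rw [b.one_of_mem_closedBall (hR hx), Complex.ofReal_one]
  have hd : Dense (besselTest (α / 2) S : Set (L2 d)) := by
    rw [Submodule.dense_iff_topologicalClosure_eq_top,
      Submodule.topologicalClosure_eq_top_iff, Submodule.eq_bot_iff]
    intro k hk
    rw [Submodule.mem_orthogonal'] at hk
    exact H k fun φ h1 h2 => hk _ ⟨φ, h1, h2, rfl⟩
  refine le_antisymm (ENNReal.le_of_forall_pos_le_add fun ε hε _ => ?_) bot_le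
  rw [zero_add]
  -- The square root appears because the capacity is a squared norm.
  obtain ⟨_, ⟨φ, h1, h2, rfl⟩, h3⟩ := Metric.mem_closure_iff.1
    (hd ((besselOp (α / 2) χ).toLp 2)) (Real.sqrt ε) (Real.sqrt_pos.2 hε)
  refine (capacity_le_of_one_le_norm hα (χ - φ) fun x hx => ?_).trans ?_
  · have : φ x = 0 := image_eq_zero_of_notMem_tsupport fun h => h2 h hx
    rw [_root_.sub_apply, hχ1 x hx, this, sub_zero, norm_one]
  · rw [dist_eq_norm] at h3
    have : ((besselOp (α / 2) (χ - φ)).toLp 2 : L2 d) =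
        (besselOp (α / 2) χ).toLp 2 volume - (besselOp (α / 2) φ).toLp 2 volume := by
      rw [map_sub, toLp_sub]
    rw [this]
    refine ENNReal.ofReal_le_of_le_toReal ?_
    exact (pow_le_pow_left₀ (norm_nonneg _) h3.le 2).trans_eq (Real.sq_sqrt ε.2)

end CapacityOfDense

/-! ### Smooth potentials from zero capacity -/

section Approximation

open Filter Topology

/-- Fatou's lemma along the neighbourhood filter, which is countably generated by first
countability. -/
theorem lowerSemicontinuous_lintegral {X Y : Type*} [TopologicalSpace X]
    [FirstCountableTopology X] [MeasurableSpace Y] {μ : Measure Y} {F : X → Y → ℝ≥0∞}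
    (hm : ∀ x, Measurable (F x)) (hc : ∀ y, Continuous fun x => F x y) :
    LowerSemicontinuous fun x => ∫⁻ y, F x y ∂μ := by
  intro x
  refine lowerSemicontinuousAt_iff_le_liminf.2 ?_
  calc ∫⁻ y, F x y ∂μ = ∫⁻ y, liminf (fun x' => F x' y) (𝓝 x) ∂μ :=
        lintegral_congr fun y => ((hc y).tendsto x).liminf_eq.symm
    _ ≤ _ := lintegral_liminf_le hm

theorem measurable_besselDensity_sub_mul (α : ℝ) {f : EuclideanSpace ℝ (Fin d) → ℝ}
    (hf : Measurable f) (x : EuclideanSpace ℝ (Fin d)) :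
    Measurable fun p : EuclideanSpace ℝ (Fin d) × ℝ =>
      ENNReal.ofReal (besselDensity α p.2 (x - p.1)) * ENNReal.ofReal (f p.1) := by
  refine Measurable.mul (Measurable.ennreal_ofReal ?_) (hf.comp measurable_fst).ennreal_ofReal
  exact (measurable_besselDensity α).comp
    (measurable_snd.prodMk (measurable_const.sub measurable_fst))

/-- Unfolding the time integral makes the integrand continuous in `x` for each fixed (y, t), as the
Fatou argument for lower semicontinuity requires. -/
theorem besselPotential_eq_lintegral_prod (α : ℝ) {f : EuclideanSpace ℝ (Fin d) → ℝ}
    (hf : Measurable f) (x : EuclideanSpace ℝ (Fin d)) :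
    besselPotential α f x = ∫⁻ p : EuclideanSpace ℝ (Fin d) × ℝ,
      ENNReal.ofReal (besselDensity α p.2 (x - p.1)) * ENNReal.ofReal (f p.1)
        ∂(volume.prod (volume.restrict (Set.Ioi 0))) := by
  rw [lintegral_prod _ (measurable_besselDensity_sub_mul α hf x).aemeasurable]
  refine lintegral_congr fun y => ?_
  have hm : Measurable fun t : ℝ => ENNReal.ofReal (besselDensity α t (x - y)) :=
    ((measurable_besselDensity α).comp measurable_prodMk_right).ennreal_ofReal
  exact (lintegral_mul_const _ hm).symm

theorem continuous_besselDensity (α t : ℝ) :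
    Continuous fun x : EuclideanSpace ℝ (Fin d) => besselDensity α t x := by
  unfold besselDensity
  fun_prop

theorem lowerSemicontinuous_besselPotential (α : ℝ) {f : EuclideanSpace ℝ (Fin d) → ℝ}
    (hf : Measurable f) : LowerSemicontinuous (besselPotential α f) := by
  rw [funext (besselPotential_eq_lintegral_prod α hf)]
  refine lowerSemicontinuous_lintegral (measurable_besselDensity_sub_mul α hf) fun p => ?_
  exact (ENNReal.continuous_mul_const ENNReal.ofReal_ne_top).comp
    (ENNReal.continuous_ofReal.comp
      ((continuous_besselDensity α p.2).comp (continuous_id.sub continuous_const)))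

/-- On a compact set, the Bessel potential of a nonnegative function is almost attained by that of
a bounded compactly supported truncation. -/
theorem exists_truncation_besselPotential {α : ℝ} {S : Set (EuclideanSpace ℝ (Fin d))}
    (hS : IsCompact S) {f : EuclideanSpace ℝ (Fin d) → ℝ} (hf : Measurable f) (hf0 : ∀ x, 0 ≤ f x)
    (h1 : ∀ x ∈ S, 1 ≤ besselPotential α f x) :
    ∃ (n : ℕ) (g : EuclideanSpace ℝ (Fin d) → ℝ), Measurable g ∧ (∀ x, 0 ≤ g x) ∧
      (∀ x, g x ≤ n) ∧ (∀ x, g x ≤ f x) ∧ (∀ x, n < ‖x‖ → g x = 0) ∧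
      ∀ x ∈ S, 2⁻¹ < besselPotential α g x := by
  set A : ℕ → Set (EuclideanSpace ℝ (Fin d)) := fun n => {y | ‖y‖ ≤ n ∧ f y ≤ n} with hA
  have hAm : ∀ n, MeasurableSet (A n) := fun n =>
    (measurableSet_le measurable_norm measurable_const).inter (measurableSet_le hf measurable_const)
  have hmono : ∀ n m, n ≤ m → A n ⊆ A m := fun n m hnm y hy =>
    ⟨hy.1.trans (by exact_mod_cast hnm), hy.2.trans (by exact_mod_cast hnm)⟩
  set g : ℕ → EuclideanSpace ℝ (Fin d) → ℝ := fun n => (A n).indicator f with hg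
  have hgm : ∀ n, Measurable (g n) := fun n => hf.indicator (hAm n)
  have hgmono : ∀ y, Monotone fun n => g n y := fun y n m hnm =>
    Set.indicator_le_indicator_of_subset (hmono n m hnm) hf0 y
  have hpmono : ∀ x, Monotone fun n => besselPotential α (g n) x := fun x n m hnm =>
    lintegral_mono fun y => mul_le_mul_right (ENNReal.ofReal_le_ofReal (hgmono y hnm)) _
  have hsup : ∀ x, besselPotential α f x = ⨆ n, besselPotential α (g n) x := by
    intro x
    simp only [besselPotential]
    rw [← lintegral_iSup]
    · refine lintegral_congr fun y => ?_
      rw [← ENNReal.mul_iSup]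
      congr 1
      refine le_antisymm ?_ (iSup_le fun n => ENNReal.ofReal_le_ofReal
        (Set.indicator_le_self' (fun _ _ => hf0 _) y))
      obtain ⟨n, hn⟩ := exists_nat_ge (max ‖y‖ (f y))
      refine le_iSup_of_le n (ENNReal.ofReal_le_ofReal ?_)
      have : y ∈ A n := ⟨(le_max_left _ _).trans hn, (le_max_right _ _).trans hn⟩
      simp [hg, this]
    · exact fun n => ((measurable_besselKernel α).comp (measurable_const.sub measurable_id)).mul
        (hgm n).ennreal_ofReal
    · intro n m hnm y
      exact mul_le_mul_right (ENNReal.ofReal_le_ofReal (hgmono y hnm)) _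
  -- By monotone convergence the superlevel sets at level 1/2 < 1 cover `S`. They are open and
  -- increase with n, so by compactness a single n suffices.
  obtain ⟨n, hn⟩ := hS.elim_directed_cover (fun n => {x | 2⁻¹ < besselPotential α (g n) x})
    (fun n => (lowerSemicontinuous_besselPotential α (hgm n)).isOpen_preimage 2⁻¹)
    (fun x hx => by
      have h2 : (2⁻¹ : ℝ≥0∞) < ⨆ n, besselPotential α (g n) x :=
        (ENNReal.inv_lt_one.2 ENNReal.one_lt_two).trans_le ((h1 x hx).trans_eq (hsup x))
      obtain ⟨n, hn⟩ := lt_iSup_iff.1 h2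
      exact Set.mem_iUnion.2 ⟨n, hn⟩)
    (directed_of_isDirected_le fun n m hnm x hx => lt_of_lt_of_le hx (hpmono x hnm))
  refine ⟨n, g n, hgm n, fun x => Set.indicator_nonneg (fun _ _ => hf0 _) x, fun x => ?_,
    Set.indicator_le_self' (fun _ _ => hf0 _), fun x hx => ?_, hn⟩
  · by_cases hx : x ∈ A n
    · simpa [hg, hx] using hx.2
    · simp [hg, hx]
  · exact Set.indicator_of_notMem (fun h => absurd h.1 (not_le.2 hx)) _

/-- Jensen's inequality for a probability density, obtained from Cauchy–Schwarz against the constant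
1. It shows that mollification does not increase the L² norm. -/
theorem sq_lintegral_mul_le {Y : Type*} [MeasurableSpace Y] {μ : Measure Y} {ρ f : Y → ℝ≥0∞}
    (hρ : Measurable ρ) (hf : Measurable f) (h1 : ∫⁻ y, ρ y ∂μ = 1) :
    (∫⁻ y, ρ y * f y ∂μ) ^ 2 ≤ ∫⁻ y, ρ y * f y ^ 2 ∂μ := by
  have h := ENNReal.lintegral_mul_le_Lp_mul_Lq (μ.withDensity ρ) (p := 2) (q := 2)
    (by constructor <;> norm_num) (f := f) (g := fun _ => 1) hf.aemeasurable
    aemeasurable_const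
  simp only [Pi.mul_apply, mul_one, ENNReal.rpow_ofNat, one_pow] at h
  rw [lintegral_withDensity_eq_lintegral_mul _ hρ hf,
    lintegral_withDensity_eq_lintegral_mul _ hρ (hf.pow_const 2),
    lintegral_withDensity_eq_lintegral_mul _ hρ measurable_const] at h
  simp only [Pi.mul_apply, mul_one, h1, ENNReal.one_rpow] at h
  calc (∫⁻ y, ρ y * f y ∂μ) ^ 2 ≤ ((∫⁻ y, ρ y * f y ^ 2 ∂μ) ^ (1 / 2 : ℝ)) ^ 2 := by gcongr
    _ = _ := by
      rw [← ENNReal.rpow_ofNat, ← ENNReal.rpow_mul]; norm_num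

/-- The mollification of a bounded compactly supported function. -/
theorem exists_mollification {ρ : EuclideanSpace ℝ (Fin d) → ℝ} (hρ : ContDiff ℝ ∞ ρ)
    (hρc : HasCompactSupport ρ) (hρ0 : ∀ x, 0 ≤ ρ x) {n : ℝ} {g : EuclideanSpace ℝ (Fin d) → ℝ}
    (hg : Measurable g) (hg0 : ∀ x, 0 ≤ g x) (hgn : ∀ x, g x ≤ n) (hgs : ∀ x, n < ‖x‖ → g x = 0) :
    ∃ F : 𝓢(EuclideanSpace ℝ (Fin d), ℝ), (∀ x, 0 ≤ F x) ∧
      ∀ x, ENNReal.ofReal (F x) = ∫⁻ z, ENNReal.ofReal (ρ z) * ENNReal.ofReal (g (x - z)) := by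
  have hgc : HasCompactSupport g :=
    HasCompactSupport.intro (isCompact_closedBall 0 n) fun x hx => hgs x (by simpa using hx)
  have hgi : Integrable g := by
    have h1 : IntegrableOn g (Metric.closedBall 0 n) :=
      Measure.integrableOn_of_bounded (isCompact_closedBall 0 n).measure_lt_top.ne
        hg.aestronglyMeasurable
        (Eventually.of_forall fun x => by rw [Real.norm_of_nonneg (hg0 x)]; exact hgn x)
    refine (integrableOn_iff_integrable_of_support_subset fun x hx => ?_).1 h1
    by_contra h
    exact hx (hgs x (by simpa using h))
  have hcd := hρc.contDiff_convolution_left (ContinuousLinearMap.lsmul ℝ ℝ) (μ := volume)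
    hρ hgi.locallyIntegrable
  have hcc := hρc.convolution (ContinuousLinearMap.lsmul ℝ ℝ) (μ := volume) hgc
  have happ : ∀ x, hcc.toSchwartzMap hcd x = ∫ z, ρ z * g (x - z) := fun x => rfl
  refine ⟨hcc.toSchwartzMap hcd, fun x => ?_, fun x => ?_⟩
  · rw [happ]; exact integral_nonneg fun z => mul_nonneg (hρ0 _) (hg0 _)
  · rw [happ, ofReal_integral_eq_lintegral_ofReal]
    · exact lintegral_congr fun z => ENNReal.ofReal_mul (hρ0 z)
    · exact (hgi.comp_sub_left x).bdd_mul hρ.continuous.aestronglyMeasurable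
        (Eventually.of_forall (hρc.exists_bound_of_continuous hρ.continuous).choose_spec)
    · exact Eventually.of_forall fun z => mul_nonneg (hρ0 _) (hg0 _)

/-- A compact set of capacity zero has small smooth Bessel potentials that are at least one near
the set. -/
theorem exists_besselOp_le_of_capacity_eq_zero {α : ℝ} (hα : 0 < α)
    {S : Set (EuclideanSpace ℝ (Fin d))} (hS : IsCompact S) (hcap : capacity α S = 0)
    {ε : ℝ} (hε : 0 < ε) :
    ∃ s : 𝓢(EuclideanSpace ℝ (Fin d), ℝ), (∀ x, 0 ≤ s x) ∧
      ‖((besselOp (α / 2) (complexify s)).toLp 2 volume : L2 d)‖ ≤ ε ∧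
      ∃ U, IsOpen U ∧ S ⊆ U ∧ ∀ x ∈ U, 1 ≤ s x := by
  -- Only half of ε is spent here: truncation lowers the potential to 1/2, and the final function is
  -- doubled.
  have hlt : capacity α S < ENNReal.ofReal ((ε / 2) ^ 2) := by rw [hcap]; positivity
  simp only [capacity, iInf_lt_iff] at hlt
  obtain ⟨f, hf0, hf1, hfε⟩ := hlt
  have hfε' : ‖f‖ ≤ ε / 2 := by
    have := (ENNReal.ofReal_lt_ofReal_iff_of_nonneg (by positivity)).1 hfε
    exact (pow_le_pow_iff_left₀ (norm_nonneg f) (by positivity) two_ne_zero).1 this.le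
  have hfm : Measurable f := (Lp.stronglyMeasurable f).measurable
  -- The representative of f is nonnegative only almost everywhere; its positive part is nonnegative
  -- at every point and has the same potential.
  have hfa : (fun x => max (f x) 0) =ᵐ[volume] f := by
    filter_upwards [(Lp.coeFn_nonneg f).2 hf0] with x hx
    exact max_eq_left hx
  obtain ⟨n, g, hgm, hg0, hgn, hgf, hgs, hg1⟩ := exists_truncation_besselPotential (α := α) hS
    (f := fun x => max (f x) 0) (hfm.max measurable_const) (fun x => le_max_right _ _)
    (fun x hx => (hf1 x hx).trans_eq (lintegral_congr_ae (by
      filter_upwards [hfa] with y hy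
      rw [hy])))
  have hUo : IsOpen {x | 2⁻¹ < besselPotential α g x} :=
    (lowerSemicontinuous_besselPotential α hgm).isOpen_preimage 2⁻¹
  -- The mollifier has support radius δ/2, so averaging at a point within δ/2 of `S` only samples
  -- points within δ of `S`, where the potential of g exceeds 1/2.
  obtain ⟨δ, hδ, hδU⟩ := hS.exists_cthickening_subset_open hUo hg1
  let b : ContDiffBump (0 : EuclideanSpace ℝ (Fin d)) :=
    ⟨δ / 4, δ / 2, by positivity, by linarith⟩
  set ρ := b.normed volume with hρ
  have hρ0 : ∀ x, 0 ≤ ρ x := b.nonneg_normed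
  have hρm : Measurable fun x => ENNReal.ofReal (ρ x) :=
    (b.continuous_normed (μ := volume)).measurable.ennreal_ofReal
  have hρ1 : ∫⁻ x, ENNReal.ofReal (ρ x) = 1 := by
    rw [← ofReal_integral_eq_lintegral_ofReal b.integrable_normed (Eventually.of_forall hρ0),
      b.integral_normed, ENNReal.ofReal_one]
  obtain ⟨F, hF0, hF⟩ := exists_mollification (ρ := ρ) b.contDiff_normed b.hasCompactSupport_normed
    hρ0 hgm hg0 hgn hgs
  obtain ⟨s, hs0, hsI, hs⟩ := exists_complexify_eq_besselOp hα F hF0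
  have hpot : ∀ x, ENNReal.ofReal (s x) = besselPotential α F x := by
    intro x
    rw [hsI, besselPotential_eq_lintegral_toReal hα, ofReal_integral_eq_lintegral_ofReal]
    · exact lintegral_congr fun y => ENNReal.ofReal_mul ENNReal.toReal_nonneg
    · refine ((integrable_toReal_besselKernel hα).comp_sub_left x).mul_bdd
        (c := SchwartzMap.seminorm ℝ 0 0 F) F.continuous.aestronglyMeasurable
        (Eventually.of_forall fun y => SchwartzMap.norm_le_seminorm ℝ F y)
    · exact Eventually.of_forall fun y => mul_nonneg ENNReal.toReal_nonneg (hF0 y)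
  -- Convolutions commute, so mollifying the density averages the translates of its potential.
  have hconv : ∀ x, besselPotential α F x =
      ∫⁻ z, ENNReal.ofReal (ρ z) * besselPotential α g (x - z) := by
    intro x
    have hm : Measurable fun p : EuclideanSpace ℝ (Fin d) × EuclideanSpace ℝ (Fin d) =>
        besselKernel α (x - p.1) * (ENNReal.ofReal (ρ p.2) * ENNReal.ofReal (g (p.1 - p.2))) := by
      refine Measurable.mul ((measurable_besselKernel α).comp (by fun_prop))
        (Measurable.mul (hρm.comp measurable_snd) ?_)
      exact hgm.ennreal_ofReal.comp (by fun_prop)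
    calc besselPotential α F x
        = ∫⁻ y, ∫⁻ z, besselKernel α (x - y) *
            (ENNReal.ofReal (ρ z) * ENNReal.ofReal (g (y - z))) := by
          refine lintegral_congr fun y => ?_
          rw [hF, lintegral_const_mul]
          exact hρm.mul (hgm.ennreal_ofReal.comp (by fun_prop))
      _ = ∫⁻ z, ∫⁻ y, besselKernel α (x - y) *
            (ENNReal.ofReal (ρ z) * ENNReal.ofReal (g (y - z))) :=
          lintegral_lintegral_swap hm.aemeasurable
      _ = _ := by
          refine lintegral_congr fun z => ?_
          rw [besselPotential, ← lintegral_const_mul, ← lintegral_add_right_eq_self _ z]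
          · refine lintegral_congr fun y => ?_
            rw [add_sub_cancel_right, sub_sub, add_comm z y]
            ring
          · exact ((measurable_besselKernel α).comp (by fun_prop)).mul hgm.ennreal_ofReal
  have hlow : ∀ x ∈ Metric.thickening (δ / 2) S, (2⁻¹ : ℝ≥0∞) ≤ besselPotential α F x := by
    intro x hx
    rw [hconv]
    calc (2⁻¹ : ℝ≥0∞) = ∫⁻ z, ENNReal.ofReal (ρ z) * 2⁻¹ := by
          rw [lintegral_mul_const _ hρm, hρ1, one_mul]
      _ ≤ _ := by
          refine lintegral_mono fun z => ?_
          by_cases hz : z ∈ Metric.ball (0 : EuclideanSpace ℝ (Fin d)) (δ / 2)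
          · gcongr
            refine le_of_lt (hδU (Metric.thickening_subset_cthickening δ S ?_))
            obtain ⟨y, hy, hxy⟩ := Metric.mem_thickening_iff.1 hx
            refine Metric.mem_thickening_iff.2 ⟨y, hy, ?_⟩
            have h1 : dist (x - z) x < δ / 2 := by simpa using hz
            linarith [dist_triangle (x - z) x y]
          · have : ρ z = 0 := by
              have h := b.support_normed_eq (μ := volume)
              by_contra hne
              exact hz (h.subset hne)
            simp [this]
  have hnorm : ‖((complexify F).toLp 2 volume : L2 d)‖ ≤ ε / 2 := by
    refine le_trans ?_ hfε'
    rw [SchwartzMap.norm_toLp, Lp.norm_def]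
    refine ENNReal.toReal_mono (Lp.eLpNorm_ne_top f) ?_
    rw [eLpNorm_eq_lintegral_rpow_enorm_toReal two_ne_zero ENNReal.ofNat_ne_top,
      eLpNorm_eq_lintegral_rpow_enorm_toReal two_ne_zero ENNReal.ofNat_ne_top]
    simp only [ENNReal.toReal_ofNat, ENNReal.rpow_ofNat]
    gcongr ?_ ^ _
    have he : ∀ x, ‖complexify F x‖ₑ = ENNReal.ofReal (F x) := fun x => by
      rw [complexify_apply, ← ofReal_norm, Complex.norm_real, Real.norm_of_nonneg (hF0 x)]
    calc ∫⁻ x, ‖complexify F x‖ₑ ^ 2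
        ≤ ∫⁻ x, ∫⁻ z, ENNReal.ofReal (ρ z) * ENNReal.ofReal (g (x - z)) ^ 2 := by
          refine lintegral_mono fun x => ?_
          rw [he, hF]
          exact sq_lintegral_mul_le hρm (hgm.ennreal_ofReal.comp (by fun_prop)) hρ1
      _ = ∫⁻ z, ∫⁻ x, ENNReal.ofReal (ρ z) * ENNReal.ofReal (g (x - z)) ^ 2 := by
          refine lintegral_lintegral_swap (Measurable.aemeasurable ?_)
          exact (hρm.comp measurable_snd).mul
            ((hgm.ennreal_ofReal.comp (measurable_fst.sub measurable_snd)).pow_const 2)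
      _ = ∫⁻ z, ENNReal.ofReal (ρ z) * ∫⁻ x, ENNReal.ofReal (g x) ^ 2 := by
          refine lintegral_congr fun z => ?_
          rw [lintegral_const_mul, lintegral_sub_right_eq_self (fun x => ENNReal.ofReal (g x) ^ 2)]
          exact (hgm.ennreal_ofReal.comp (by fun_prop)).pow_const 2
      _ = ∫⁻ x, ENNReal.ofReal (g x) ^ 2 := by
          rw [lintegral_mul_const _ hρm, hρ1, one_mul]
      _ ≤ ∫⁻ x, ‖f x‖ₑ ^ 2 := by
          refine lintegral_mono_ae ?_
          filter_upwards [hfa] with x hx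
          gcongr
          rw [← ofReal_norm]
          refine ENNReal.ofReal_le_ofReal (((hgf x).trans_eq hx).trans (Real.le_norm_self _))
  refine ⟨(2 : ℝ) • s, fun x => ?_, ?_, Metric.thickening (δ / 2) S, Metric.isOpen_thickening,
    Metric.self_subset_thickening (by positivity) S, fun x hx => ?_⟩
  · exact mul_nonneg zero_le_two (hs0 x)
  · have h2 : besselOp (α / 2) (complexify ((2 : ℝ) • s)) = (2 : ℝ) • complexify F := by
      have : complexify ((2 : ℝ) • s) = (2 : ℝ) • complexify s := by
        ext x; simp
      rw [this, map_smul, hs, besselOp_besselOp, add_neg_cancel, besselOp_zero]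
    rw [h2]
    have h3 : (((2 : ℝ) • complexify F).toLp 2 volume : L2 d) =
        (2 : ℝ) • (complexify F).toLp 2 volume :=
      map_smul (SchwartzMap.toLpCLM ℝ ℂ 2 volume) _ _
    rw [h3, norm_smul, Real.norm_ofNat]
    linarith
  · have h4 := (hlow x hx).trans_eq (hpot x).symm
    have h5 : (2⁻¹ : ℝ) ≤ s x := by
      have := ENNReal.toReal_mono ENNReal.ofReal_ne_top h4
      rwa [ENNReal.toReal_ofReal (hs0 x), ENNReal.toReal_inv, ENNReal.toReal_ofNat] at this
    change 1 ≤ 2 * s x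
    linarith

end Approximation

/-! ### Sobolev bounds by Plancherel -/

section PlancherelBounds

theorem sq_norm_toLp (f : 𝓢(EuclideanSpace ℝ (Fin d), ℂ)) :
    ‖(f.toLp 2 volume : L2 d)‖ ^ 2 = ∫ x, ‖f x‖ ^ 2 := by
  rw [SchwartzMap.norm_toLp' two_ne_zero ENNReal.ofNat_ne_top]
  simp only [ENNReal.toReal_ofNat, Real.rpow_ofNat]
  rw [← Real.rpow_natCast, ← Real.rpow_mul (integral_nonneg fun x => by positivity)]
  norm_num

theorem integrable_sq_norm (f : 𝓢(EuclideanSpace ℝ (Fin d), ℂ)) :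
    Integrable fun x => ‖f x‖ ^ 2 :=
  (memLp_two_iff_integrable_sq_norm f.continuous.aestronglyMeasurable).1 (f.memLp 2 volume)

theorem norm_toLp_le_mul_of_fourier_le {f g : 𝓢(EuclideanSpace ℝ (Fin d), ℂ)} {C : ℝ}
    (h : ∀ ξ, ‖𝓕 f ξ‖ ≤ C * ‖𝓕 g ξ‖) :
    ‖(f.toLp 2 volume : L2 d)‖ ≤ C * ‖(g.toLp 2 volume : L2 d)‖ := by
  rw [← SchwartzMap.norm_fourier_toL2_eq, ← SchwartzMap.norm_fourier_toL2_eq g]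
  refine Lp.norm_le_mul_norm_of_ae_le_mul ?_
  filter_upwards [(𝓕 f).coeFn_toLp 2 volume, (𝓕 g).coeFn_toLp 2 volume] with ξ h1 h2
  rw [h1, h2]
  exact h ξ

theorem norm_toLp_le_mul_of_norm_le {f g : 𝓢(EuclideanSpace ℝ (Fin d), ℂ)} {C : ℝ}
    (h : ∀ x, ‖f x‖ ≤ C * ‖g x‖) :
    ‖(f.toLp 2 volume : L2 d)‖ ≤ C * ‖(g.toLp 2 volume : L2 d)‖ := by
  refine Lp.norm_le_mul_norm_of_ae_le_mul ?_
  filter_upwards [f.coeFn_toLp 2 volume, g.coeFn_toLp 2 volume] with ξ h1 h2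
  rw [h1, h2]
  exact h ξ

theorem fourier_lineDerivOp_apply (m : EuclideanSpace ℝ (Fin d))
    (f : 𝓢(EuclideanSpace ℝ (Fin d), ℂ)) (ξ : EuclideanSpace ℝ (Fin d)) :
    𝓕 (∂_{m} f) ξ = (2 * Real.pi * Complex.I * (inner ℝ ξ m : ℝ)) * 𝓕 f ξ := by
  rw [SchwartzMap.fourier_lineDerivOp_eq, _root_.smul_apply,
    SchwartzMap.smulLeftCLM_apply_apply (by fun_prop), smul_eq_mul, Complex.real_smul]
  ring

theorem norm_fourier_lineDerivOp_le {m : EuclideanSpace ℝ (Fin d)} (hm : ‖m‖ = 1)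
    (f : 𝓢(EuclideanSpace ℝ (Fin d), ℂ)) (ξ : EuclideanSpace ℝ (Fin d)) :
    ‖𝓕 (∂_{m} f) ξ‖ ≤ 2 * Real.pi * ‖ξ‖ * ‖𝓕 f ξ‖ := by
  rw [fourier_lineDerivOp_apply, norm_mul]
  gcongr
  have h := norm_inner_le_norm (𝕜 := ℝ) ξ m
  rw [hm, mul_one] at h
  simp only [norm_mul, Complex.norm_ofNat, Complex.norm_real, Complex.norm_I, mul_one]
  rw [Real.norm_of_nonneg Real.pi_pos.le]
  gcongr

theorem norm_fourier_besselOp (s : ℝ) (f : 𝓢(EuclideanSpace ℝ (Fin d), ℂ))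
    (ξ : EuclideanSpace ℝ (Fin d)) : ‖𝓕 (besselOp s f) ξ‖ = weight ξ ^ s * ‖𝓕 f ξ‖ := by
  rw [fourier_besselOp_apply, norm_smul,
    Real.norm_of_nonneg (Real.rpow_nonneg (weight_pos ξ).le _)]

theorem norm_toLp_le_besselOp {s : ℝ} (hs : 0 ≤ s) (f : 𝓢(EuclideanSpace ℝ (Fin d), ℂ)) :
    ‖(f.toLp 2 volume : L2 d)‖ ≤ ‖((besselOp s f).toLp 2 volume : L2 d)‖ := by
  rw [← one_mul ‖((besselOp s f).toLp 2 volume : L2 d)‖]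
  refine norm_toLp_le_mul_of_fourier_le fun ξ => ?_
  rw [norm_fourier_besselOp, one_mul]
  exact le_mul_of_one_le_left (norm_nonneg _) (Real.one_le_rpow (one_le_weight ξ) hs)

theorem norm_besselOp_le_besselOp {s t : ℝ} (hst : s ≤ t) (f : 𝓢(EuclideanSpace ℝ (Fin d), ℂ)) :
    ‖((besselOp s f).toLp 2 volume : L2 d)‖ ≤ ‖((besselOp t f).toLp 2 volume : L2 d)‖ := by
  have := norm_toLp_le_besselOp (sub_nonneg.2 hst) (besselOp s f)
  rwa [besselOp_besselOp, sub_add_cancel] at this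

theorem norm_lineDerivOp_le_besselOp {m : EuclideanSpace ℝ (Fin d)} (hm : ‖m‖ = 1)
    (f : 𝓢(EuclideanSpace ℝ (Fin d), ℂ)) :
    ‖((∂_{m} f).toLp 2 volume : L2 d)‖ ≤ ‖((besselOp 1 f).toLp 2 volume : L2 d)‖ := by
  rw [← one_mul ‖((besselOp 1 f).toLp 2 volume : L2 d)‖]
  refine norm_toLp_le_mul_of_fourier_le fun ξ => ?_
  rw [norm_fourier_besselOp, one_mul, Real.rpow_one]
  refine (norm_fourier_lineDerivOp_le hm f ξ).trans ?_
  gcongr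
  rw [weight]
  nlinarith [sq_nonneg (2 * Real.pi * ‖ξ‖ - 1)]

theorem norm_lineDerivOp_lineDerivOp_le_besselOp {m : EuclideanSpace ℝ (Fin d)} (hm : ‖m‖ = 1)
    (f : 𝓢(EuclideanSpace ℝ (Fin d), ℂ)) :
    ‖((∂_{m} (∂_{m} f)).toLp 2 volume : L2 d)‖ ≤ ‖((besselOp 1 f).toLp 2 volume : L2 d)‖ := by
  rw [← one_mul ‖((besselOp 1 f).toLp 2 volume : L2 d)‖]
  refine norm_toLp_le_mul_of_fourier_le fun ξ => ?_
  rw [norm_fourier_besselOp, one_mul, Real.rpow_one]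
  calc ‖𝓕 (∂_{m} (∂_{m} f)) ξ‖ ≤ 2 * Real.pi * ‖ξ‖ * (2 * Real.pi * ‖ξ‖ * ‖𝓕 f ξ‖) := by
        refine (norm_fourier_lineDerivOp_le hm _ ξ).trans ?_
        gcongr
        exact norm_fourier_lineDerivOp_le hm f ξ
    _ ≤ weight ξ * ‖𝓕 f ξ‖ := by
        rw [← mul_assoc]
        gcongr
        rw [weight]
        nlinarith

theorem besselOp_one_eq (f : 𝓢(EuclideanSpace ℝ (Fin d), ℂ)) :
    besselOp 1 f = f - ∑ i : Fin d, ∂_{EuclideanSpace.single i (1 : ℝ)}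
      (∂_{EuclideanSpace.single i (1 : ℝ)} f) := fourier_ext fun ξ => by
  have h : (𝓕 (f - ∑ i : Fin d, ∂_{EuclideanSpace.single i (1 : ℝ)}
      (∂_{EuclideanSpace.single i (1 : ℝ)} f)) : 𝓢(EuclideanSpace ℝ (Fin d), ℂ)) =
      𝓕 f - ∑ i : Fin d, 𝓕 (∂_{EuclideanSpace.single i (1 : ℝ)}
        (∂_{EuclideanSpace.single i (1 : ℝ)} f)) := by
    change fourierCLM ℂ 𝓢(EuclideanSpace ℝ (Fin d), ℂ) _ = _
    rw [map_sub, map_sum]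
    rfl
  rw [h, fourier_besselOp_apply, _root_.sub_apply, _root_.sum_apply]
  simp only [fourier_lineDerivOp_apply]
  have h2 : (weight ξ : ℂ) = 1 + ∑ i, (2 * Real.pi * (ξ i : ℂ)) ^ 2 := by
    rw [weight, mul_pow, EuclideanSpace.real_norm_sq_eq, Finset.mul_sum]
    push_cast
    simp only [mul_pow]
  rw [Real.rpow_one, Complex.real_smul, h2, add_mul, one_mul, sub_eq_add_neg, Finset.sum_mul,
    ← Finset.sum_neg_distrib]
  congr 1
  refine Finset.sum_congr rfl fun i _ => ?_
  simp only [EuclideanSpace.inner_single_right, conj_trivial, one_mul]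
  linear_combination ((2 * Real.pi * (ξ i : ℂ)) ^ 2 * 𝓕 f ξ) * Complex.I_sq

/-- Only pure second derivatives enter, so later estimates can treat one coordinate direction at a
time. -/
theorem norm_besselOp_one_le (f : 𝓢(EuclideanSpace ℝ (Fin d), ℂ)) :
    ‖((besselOp 1 f).toLp 2 volume : L2 d)‖ ≤ ‖(f.toLp 2 volume : L2 d)‖ +
      ∑ i : Fin d, ‖((∂_{EuclideanSpace.single i (1 : ℝ)}
        (∂_{EuclideanSpace.single i (1 : ℝ)} f)).toLp 2 volume : L2 d)‖ := by
  have h : ((∑ i : Fin d, ∂_{EuclideanSpace.single i (1 : ℝ)}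
      (∂_{EuclideanSpace.single i (1 : ℝ)} f)).toLp 2 volume : L2 d) =
      ∑ i : Fin d, (∂_{EuclideanSpace.single i (1 : ℝ)}
        (∂_{EuclideanSpace.single i (1 : ℝ)} f)).toLp 2 volume :=
    map_sum (SchwartzMap.toLpCLM ℂ ℂ 2 volume) _ _
  rw [besselOp_one_eq, toLp_sub, h]
  exact (norm_sub_le _ _).trans (add_le_add le_rfl (norm_sum_le _ _))

end PlancherelBounds

/-! ### The L² bound for (∂u)²/(1 + u) -/

section IntegrationByParts

theorem hasLineDerivAt_schwartz {F : Type*} [NormedAddCommGroup F] [NormedSpace ℝ F]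
    (f : 𝓢(EuclideanSpace ℝ (Fin d), F)) (m x : EuclideanSpace ℝ (Fin d)) :
    HasLineDerivAt ℝ f (∂_{m} f x) x m := by
  rw [SchwartzMap.lineDerivOp_apply_eq_fderiv]
  exact f.differentiableAt.hasFDerivAt.hasLineDerivAt m

theorem lineDerivOp_complexify (m : EuclideanSpace ℝ (Fin d))
    (u : 𝓢(EuclideanSpace ℝ (Fin d), ℝ)) : ∂_{m} (complexify u) = complexify (∂_{m} u) := by
  ext x
  have h1 := hasLineDerivAt_schwartz (complexify u) m x
  have h2 : HasLineDerivAt ℝ (complexify u) (complexify (∂_{m} u) x) x m :=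
    HasDerivAt.ofReal_comp (hasLineDerivAt_schwartz u m x)
  exact HasDerivAt.unique h1 h2

theorem integrable_mul_schwartz {b : EuclideanSpace ℝ (Fin d) → ℝ} (hb : Continuous b) {C : ℝ}
    (hC : ∀ x, ‖b x‖ ≤ C) (f : 𝓢(EuclideanSpace ℝ (Fin d), ℝ)) :
    Integrable fun x => b x * f x :=
  (f.integrable (μ := volume)).bdd_mul hb.aestronglyMeasurable (Filter.Eventually.of_forall hC)

/-- The quadratic quantity `|∂u|² / (1 + u)` of a nonnegative function `u` is controlled in `L²` by
the second derivative `∂∂u`. -/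
theorem integral_sq_lineDerivOp_div_le (u : 𝓢(EuclideanSpace ℝ (Fin d), ℝ)) (hu : ∀ x, 0 ≤ u x)
    (m : EuclideanSpace ℝ (Fin d)) :
    Integrable (fun x => (∂_{m} u x ^ 2 / (1 + u x)) ^ 2) ∧
    ∫ x, (∂_{m} u x ^ 2 / (1 + u x)) ^ 2 ≤ 9 * ∫ x, ∂_{m} (∂_{m} u) x ^ 2 := by
  set D := ∂_{m} u with hD
  set D2 := ∂_{m} D with hD2
  have hpos : ∀ x, 0 < 1 + u x := fun x => by linarith [hu x]
  set B := SchwartzMap.seminorm ℝ 0 0 D with hB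
  have hDB : ∀ x, |D x| ≤ B := fun x => SchwartzMap.norm_le_seminorm ℝ D x
  have hB0 : 0 ≤ B := (abs_nonneg _).trans (hDB 0)
  have hinv : ∀ x, |(1 + u x)⁻¹| ≤ 1 := fun x => by
    rw [abs_of_pos (inv_pos.2 (hpos x))]
    exact inv_le_one_of_one_le₀ (by linarith [hu x])
  have hcinv : Continuous fun x => (1 + u x)⁻¹ :=
    (continuous_const.add u.continuous).inv₀ fun x => (hpos x).ne'
  have hDu : ∀ x, HasFDerivAt u (fderiv ℝ u x) x := fun x => u.differentiableAt.hasFDerivAt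
  have hDD : ∀ x, HasFDerivAt D (fderiv ℝ D x) x := fun x => D.differentiableAt.hasFDerivAt
  have hf : ∀ x, HasFDerivAt (fun x => (1 + u x)⁻¹) (-((1 + u x) ^ 2)⁻¹ • fderiv ℝ u x) x :=
    fun x => (hasDerivAt_inv (hpos x).ne').comp_hasFDerivAt x ((hDu x).const_add 1)
  have hg : ∀ x, HasFDerivAt (fun x => D x ^ 3) ((3 * D x ^ 2) • fderiv ℝ D x) x :=
    fun x => by simpa using (hDD x).pow 3
  have hf' : ∀ x, fderiv ℝ (fun x => (1 + u x)⁻¹) x m = -(((1 + u x)⁻¹) ^ 2 * D x) := fun x => by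
    rw [(hf x).fderiv, hD, SchwartzMap.lineDerivOp_apply_eq_fderiv]
    simp
  have hg' : ∀ x, fderiv ℝ (fun x => D x ^ 3) x m = 3 * D x ^ 2 * D2 x := fun x => by
    rw [(hg x).fderiv, _root_.smul_apply, smul_eq_mul, hD2,
      SchwartzMap.lineDerivOp_apply_eq_fderiv m D]
  have hi4 : Integrable fun x => (((1 + u x)⁻¹) ^ 2 * D x ^ 3) * D x := by
    refine integrable_mul_schwartz (C := 1 ^ 2 * B ^ 3) ((hcinv.pow 2).mul (D.continuous.pow 3))
      (fun x => ?_) D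
    change |((1 + u x)⁻¹) ^ 2 * D x ^ 3| ≤ _
    rw [abs_mul, abs_pow, abs_pow]
    gcongr
    exacts [hinv x, hDB x]
  have hi2 : Integrable fun x => ((1 + u x)⁻¹ * (3 * D x ^ 2)) * D2 x := by
    refine integrable_mul_schwartz (C := 1 * (3 * B ^ 2))
      (hcinv.mul (continuous_const.mul (D.continuous.pow 2))) (fun x => ?_) D2
    change |(1 + u x)⁻¹ * (3 * D x ^ 2)| ≤ _
    rw [abs_mul, abs_mul, abs_pow, abs_of_pos (three_pos (α := ℝ))]
    gcongr
    exacts [hinv x, hDB x]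
  have hi3 : Integrable fun x => ((1 + u x)⁻¹ * D x ^ 2) * D x := by
    refine integrable_mul_schwartz (C := 1 * B ^ 2)
      (hcinv.mul (D.continuous.pow 2)) (fun x => ?_) D
    change |(1 + u x)⁻¹ * D x ^ 2| ≤ _
    rw [abs_mul, abs_pow]
    gcongr
    exacts [hinv x, hDB x]
  -- Since ∂((1 + u)⁻¹) = -∂u/(1 + u)², pairing with (∂u)³ turns ∫ (∂u)⁴/(1 + u)² into 3 ∫ (∂u)²
  -- ∂∂u/(1 + u).
  have hibp := integral_mul_fderiv_eq_neg_fderiv_mul_of_integrable (μ := volume) (v := m)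
    (f := fun x => (1 + u x)⁻¹) (g := fun x => D x ^ 3)
    (hi4.neg.congr (Filter.Eventually.of_forall fun x => by
      simp only [Pi.neg_apply, hf']; ring))
    (hi2.congr (Filter.Eventually.of_forall fun x => by simp only [hg']; ring))
    (hi3.congr (Filter.Eventually.of_forall fun x => by ring))
    (fun x _ => (hf x).differentiableAt) (fun x _ => (hg x).differentiableAt)
  simp only [hf', hg'] at hibp
  have hXi : Integrable fun x => (D x ^ 2 / (1 + u x)) ^ 2 :=
    hi4.congr (Filter.Eventually.of_forall fun x => by
      have := (hpos x).ne'
      field_simp)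
  refine ⟨hXi, ?_⟩
  have hX : ∫ x, (D x ^ 2 / (1 + u x)) ^ 2 = ∫ x, (1 + u x)⁻¹ * (3 * D x ^ 2) * D2 x := by
    have e1 : ∫ x, (D x ^ 2 / (1 + u x)) ^ 2 = -∫ x, -(((1 + u x)⁻¹) ^ 2 * D x) * D x ^ 3 := by
      rw [← integral_neg]
      congr 1 with x
      have := (hpos x).ne'
      field_simp
    rw [e1, ← hibp]
    congr 1 with x
    ring
  have hD2i : Integrable fun x => D2 x ^ 2 := by
    have := integrable_sq_norm (complexify D2)
    simpa using this
  have hle : ∫ x, (1 + u x)⁻¹ * (3 * D x ^ 2) * D2 x ≤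
      ∫ x, (2⁻¹ * (D x ^ 2 / (1 + u x)) ^ 2 + 9 / 2 * D2 x ^ 2) := by
    refine integral_mono hi2 ((hXi.const_mul _).add (hD2i.const_mul _)) fun x => ?_
    have : (1 + u x)⁻¹ * (3 * D x ^ 2) * D2 x = 3 * (D x ^ 2 / (1 + u x)) * D2 x := by
      have := (hpos x).ne'
      field_simp
    simp only [this]
    -- Young's inequality 3ab ≤ a²/2 + 9b²/2; the a² part is absorbed on the left, which gives the
    -- constant 9.
    nlinarith [sq_nonneg (D x ^ 2 / (1 + u x) - 3 * D2 x)]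
  rw [integral_add (hXi.const_mul _) (hD2i.const_mul _), integral_const_mul,
    integral_const_mul, ← hX] at hle
  linarith

end IntegrationByParts

/-! ### Bounds for the smooth step function -/

section SmoothTransition

theorem deriv_smoothTransition_eq_zero {s : ℝ} (hs : s ∉ Set.Icc (0 : ℝ) 1) :
    deriv Real.smoothTransition s = 0 := by
  rw [Set.mem_Icc, not_and_or, not_le, not_le] at hs
  rcases hs with h | h
  · have : Real.smoothTransition =ᶠ[nhds s] fun _ => 0 := by
      filter_upwards [Iio_mem_nhds h] with t ht
      exact Real.smoothTransition.zero_of_nonpos (le_of_lt ht)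
    rw [this.deriv_eq, deriv_const]
  · have : Real.smoothTransition =ᶠ[nhds s] fun _ => 1 := by
      filter_upwards [Ioi_mem_nhds h] with t ht
      exact Real.smoothTransition.one_of_one_le (le_of_lt ht)
    rw [this.deriv_eq, deriv_const]

theorem hasCompactSupport_deriv_smoothTransition :
    HasCompactSupport (deriv Real.smoothTransition) :=
  HasCompactSupport.intro isCompact_Icc fun _ => deriv_smoothTransition_eq_zero

theorem contDiff_deriv_smoothTransition : ContDiff ℝ ∞ (deriv Real.smoothTransition) :=
  (contDiff_infty_iff_deriv.1 Real.smoothTransition.contDiff).2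

/-- The first derivative is supported in [0, 1], hence so is the second, and the weight 1 + |s| in
the last bound costs only a constant. That weight provides the denominator 1 + u in the truncation
estimate. -/
theorem exists_smoothTransition_bound : ∃ B : ℝ, 0 ≤ B ∧
    (∀ s, |Real.smoothTransition s| ≤ B * |s|) ∧
    (∀ s t, |Real.smoothTransition s - Real.smoothTransition t| ≤ B * |s - t|) ∧
    (∀ s, |deriv Real.smoothTransition s| ≤ B) ∧
    ∀ s, |deriv (deriv Real.smoothTransition) s| * (1 + |s|) ≤ B := by
  obtain ⟨B1, hB1⟩ := hasCompactSupport_deriv_smoothTransition.exists_bound_of_continuous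
    contDiff_deriv_smoothTransition.continuous
  have hc2 : Continuous (deriv (deriv Real.smoothTransition)) :=
    contDiff_deriv_smoothTransition.continuous_deriv (by simp)
  obtain ⟨B2, hB2⟩ := (hasCompactSupport_deriv_smoothTransition.deriv.mul_right
    (f' := fun s => 1 + |s|)).exists_bound_of_continuous
    (hc2.mul (continuous_const.add continuous_abs))
  have hB1' : ∀ s, |deriv Real.smoothTransition s| ≤ max B1 B2 := fun s =>
    (hB1 s).trans (le_max_left _ _)
  have hL : ∀ s t, |Real.smoothTransition s - Real.smoothTransition t| ≤ max B1 B2 * |s - t| :=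
    fun s t => Convex.norm_image_sub_le_of_norm_deriv_le (s := Set.univ)
      (fun x _ => (Real.smoothTransition.contDiff (n := ⊤)).differentiable (by simp) x)
      (fun x _ => hB1' x) convex_univ (Set.mem_univ t) (Set.mem_univ s)
  refine ⟨max B1 B2, (abs_nonneg _).trans (hB1' 0), fun s => ?_, hL, hB1', fun s => ?_⟩
  · simpa [Real.smoothTransition.zero] using hL s 0
  · refine le_trans (le_trans (le_of_eq ?_) (hB2 s)) (le_max_right _ _)
    rw [Pi.mul_apply, norm_mul, Real.norm_eq_abs, Real.norm_eq_abs,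
      abs_of_nonneg (by positivity : 0 ≤ 1 + |s|)]

end SmoothTransition

/-! ### Truncation in the second-order norm -/

section Truncation

theorem HasLineDerivAt.smul_schwartz {G : EuclideanSpace ℝ (Fin d) → ℝ} {G' : ℝ}
    {m x : EuclideanSpace ℝ (Fin d)} (hG : HasLineDerivAt ℝ G G' x m)
    (φ : 𝓢(EuclideanSpace ℝ (Fin d), ℂ)) :
    HasLineDerivAt ℝ (fun y => G y • φ y) (G' • φ x + G x • ∂_{m} φ x) x m := by
  have := HasDerivAt.smul hG (hasLineDerivAt_schwartz φ m x)
  simp only [zero_smul, add_zero] at this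
  rw [add_comm] at this
  exact this

theorem lineDerivOp_lineDerivOp_of_eq_smul {G G1 G2 : EuclideanSpace ℝ (Fin d) → ℝ}
    {m : EuclideanSpace ℝ (Fin d)} (hG : ∀ x, HasLineDerivAt ℝ G (G1 x) x m)
    (hG1 : ∀ x, HasLineDerivAt ℝ G1 (G2 x) x m)
    {v φ : 𝓢(EuclideanSpace ℝ (Fin d), ℂ)} (hv : ∀ x, v x = G x • φ x)
    (x : EuclideanSpace ℝ (Fin d)) :
    ∂_{m} (∂_{m} v) x = G2 x • φ x + 2 * (G1 x • ∂_{m} φ x) + G x • ∂_{m} (∂_{m} φ) x := by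
  have h1 : ∀ y, ∂_{m} v y = G1 y • φ y + G y • ∂_{m} φ y := fun y => by
    refine HasDerivAt.unique (hasLineDerivAt_schwartz v m y) ?_
    rw [funext hv]
    exact HasLineDerivAt.smul_schwartz (hG y) φ
  have h2 : HasLineDerivAt ℝ (⇑(∂_{m} v : 𝓢(EuclideanSpace ℝ (Fin d), ℂ)))
      ((G2 x • φ x + G1 x • ∂_{m} φ x) +
      (G1 x • ∂_{m} φ x + G x • ∂_{m} (∂_{m} φ) x)) x m := by
    rw [funext h1]
    exact HasDerivAt.add (HasLineDerivAt.smul_schwartz (hG1 x) φ)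
      (HasLineDerivAt.smul_schwartz (hG x) _)
  rw [HasDerivAt.unique (hasLineDerivAt_schwartz (∂_{m} v) m x) h2, two_mul]
  abel

theorem contDiff_smoothTransition_smul (φ : 𝓢(EuclideanSpace ℝ (Fin d), ℂ))
    (u : 𝓢(EuclideanSpace ℝ (Fin d), ℝ)) :
    ContDiff ℝ ∞ fun x => Real.smoothTransition (u x) • φ x :=
  (Real.smoothTransition.contDiff.comp (u.smooth ⊤)).smul (φ.smooth ⊤)

/-- The truncation `H(u) φ` of a compactly supported `φ`, where `H` is a smooth transition
function from `0` to `1`. -/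
noncomputable def truncMul (φ : 𝓢(EuclideanSpace ℝ (Fin d), ℂ)) (hφ : HasCompactSupport φ)
    (u : 𝓢(EuclideanSpace ℝ (Fin d), ℝ)) : 𝓢(EuclideanSpace ℝ (Fin d), ℂ) :=
  (hφ.smul_left (f := fun x => Real.smoothTransition (u x))).toSchwartzMap
    (contDiff_smoothTransition_smul φ u)

theorem truncMul_apply (φ : 𝓢(EuclideanSpace ℝ (Fin d), ℂ)) (hφ : HasCompactSupport φ)
    (u : 𝓢(EuclideanSpace ℝ (Fin d), ℝ)) (x : EuclideanSpace ℝ (Fin d)) :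
    truncMul φ hφ u x = Real.smoothTransition (u x) • φ x := rfl

/-- The step function is Lipschitz and φ is bounded. Truncation is nonlinear, so the interpolation
needs this bound for differences and not merely for single functions. -/
theorem exists_norm_truncMul_sub_le (φ : 𝓢(EuclideanSpace ℝ (Fin d), ℂ))
    (hφ : HasCompactSupport φ) : ∃ C : ℝ, 0 ≤ C ∧ ∀ u s : 𝓢(EuclideanSpace ℝ (Fin d), ℝ),
      ‖((truncMul φ hφ u - truncMul φ hφ s).toLp 2 volume : L2 d)‖ ≤
        C * ‖((complexify u - complexify s).toLp 2 volume : L2 d)‖ := by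
  obtain ⟨B, hB0, -, hB, -⟩ := exists_smoothTransition_bound
  refine ⟨B * SchwartzMap.seminorm ℝ 0 0 φ, by positivity, fun u s =>
    norm_toLp_le_mul_of_norm_le fun x => ?_⟩
  rw [_root_.sub_apply, _root_.sub_apply, truncMul_apply, truncMul_apply, ← sub_smul, norm_smul,
    complexify_apply, complexify_apply, ← Complex.ofReal_sub, Complex.norm_real, mul_right_comm]
  gcongr
  exacts [hB _ _, SchwartzMap.norm_le_seminorm ℝ φ x]

theorem exists_norm_truncMul_le (φ : 𝓢(EuclideanSpace ℝ (Fin d), ℂ))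
    (hφ : HasCompactSupport φ) : ∃ C : ℝ, 0 ≤ C ∧ ∀ u : 𝓢(EuclideanSpace ℝ (Fin d), ℝ),
      ‖((truncMul φ hφ u).toLp 2 volume : L2 d)‖ ≤
        C * ‖((complexify u).toLp 2 volume : L2 d)‖ := by
  obtain ⟨C, hC0, hC⟩ := exists_norm_truncMul_sub_le φ hφ
  refine ⟨C, hC0, fun u => ?_⟩
  have h1 : truncMul φ hφ u - truncMul φ hφ 0 = truncMul φ hφ u := by
    ext x
    simp [truncMul_apply, Real.smoothTransition.zero]
  have h2 : complexify u - complexify (0 : 𝓢(EuclideanSpace ℝ (Fin d), ℝ)) = complexify u := by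
    ext x
    simp
  have := hC u 0
  rwa [h1, h2] at this

/-- The product and chain rules produce one quadratic term, H''(u)(∂u)²φ. The weighted bound on H''
converts it to (∂u)²/(1 + u); all other terms are linear in u and its derivatives. -/
theorem exists_norm_lineDerivOp_truncMul_le (φ : 𝓢(EuclideanSpace ℝ (Fin d), ℂ))
    (hφ : HasCompactSupport φ) (m : EuclideanSpace ℝ (Fin d)) :
    ∃ C : ℝ, 0 ≤ C ∧ ∀ u : 𝓢(EuclideanSpace ℝ (Fin d), ℝ), (∀ x, 0 ≤ u x) → ∀ x,
      ‖∂_{m} (∂_{m} (truncMul φ hφ u)) x‖ ≤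
        C * (|u x| + 2 * |∂_{m} u x| + |∂_{m} (∂_{m} u) x| + ∂_{m} u x ^ 2 / (1 + u x)) := by
  obtain ⟨B, hB0, hH, -, hH1, hH2⟩ := exists_smoothTransition_bound
  obtain ⟨A, hA0, hA⟩ : ∃ A : ℝ, 0 ≤ A ∧ ∀ x, ‖φ x‖ ≤ A ∧ ‖∂_{m} φ x‖ ≤ A ∧
      ‖∂_{m} (∂_{m} φ) x‖ ≤ A := by
    refine ⟨SchwartzMap.seminorm ℝ 0 0 φ + SchwartzMap.seminorm ℝ 0 0 (∂_{m} φ) +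
      SchwartzMap.seminorm ℝ 0 0 (∂_{m} (∂_{m} φ)), by positivity, fun x => ?_⟩
    have h1 := SchwartzMap.norm_le_seminorm ℝ φ x
    have h2 := SchwartzMap.norm_le_seminorm ℝ (∂_{m} φ) x
    have h3 := SchwartzMap.norm_le_seminorm ℝ (∂_{m} (∂_{m} φ)) x
    have h4 := (norm_nonneg _).trans h1
    have h5 := (norm_nonneg _).trans h2
    have h6 := (norm_nonneg _).trans h3
    exact ⟨by linarith, by linarith, by linarith⟩
  refine ⟨B * A, by positivity, fun u hu x => ?_⟩
  set H := Real.smoothTransition with hHdef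
  have hdH : ∀ s, HasDerivAt H (deriv H s) s := fun s =>
    ((Real.smoothTransition.contDiff (n := ⊤)).differentiable (by simp) s).hasDerivAt
  have hddH : ∀ s, HasDerivAt (deriv H) (deriv (deriv H) s) s := fun s =>
    (contDiff_deriv_smoothTransition.differentiable (by simp) s).hasDerivAt
  have hcomp : ∀ {K : ℝ → ℝ} {K' : ℝ} (y : EuclideanSpace ℝ (Fin d)),
      HasDerivAt K K' (u y) → HasLineDerivAt ℝ (fun z => K (u z)) (K' * ∂_{m} u y) y m := by
    intro K K' y hK
    refine HasDerivAt.comp (h₂ := K) (h := fun t : ℝ => u (y + t • m)) 0 ?_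
      (hasLineDerivAt_schwartz u m y)
    simpa using hK
  have hG : ∀ y, HasLineDerivAt ℝ (fun z => H (u z)) (deriv H (u y) * ∂_{m} u y) y m :=
    fun y => hcomp y (hdH _)
  have hG1 : ∀ y, HasLineDerivAt ℝ (fun z => deriv H (u z) * ∂_{m} u z)
      (deriv (deriv H) (u y) * ∂_{m} u y * ∂_{m} u y + deriv H (u y) * ∂_{m} (∂_{m} u) y) y m :=
    fun y => by
      have := HasDerivAt.mul (hcomp y (hddH _)) (hasLineDerivAt_schwartz (∂_{m} u) m y)
      simp only [zero_smul, add_zero] at this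
      exact this
  rw [lineDerivOp_lineDerivOp_of_eq_smul hG hG1 (truncMul_apply φ hφ u)]
  have hpos : 0 < 1 + u x := by linarith [hu x]
  have e1 : |deriv (deriv H) (u x) * ∂_{m} u x * ∂_{m} u x| ≤
      B * (∂_{m} u x ^ 2 / (1 + u x)) := by
    have := hH2 (u x)
    rw [abs_of_nonneg (hu x)] at this
    rw [mul_assoc, ← sq, abs_mul, abs_of_nonneg (sq_nonneg (∂_{m} u x)), ← mul_div_assoc,
      le_div_iff₀ hpos]
    nlinarith [mul_le_mul_of_nonneg_right this (sq_nonneg (∂_{m} u x))]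
  have e2 : |deriv H (u x) * ∂_{m} (∂_{m} u) x| ≤ B * |∂_{m} (∂_{m} u) x| := by
    rw [abs_mul]; gcongr; exact hH1 _
  have e3 : |deriv H (u x) * ∂_{m} u x| ≤ B * |∂_{m} u x| := by
    rw [abs_mul]; gcongr; exact hH1 _
  have hq : 0 ≤ ∂_{m} u x ^ 2 / (1 + u x) := by positivity
  obtain ⟨a1, a2, a3⟩ := hA x
  calc _ ≤ ‖(deriv (deriv H) (u x) * ∂_{m} u x * ∂_{m} u x +
          deriv H (u x) * ∂_{m} (∂_{m} u) x) • φ x‖ +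
        ‖2 * ((deriv H (u x) * ∂_{m} u x) • ∂_{m} φ x)‖ + ‖H (u x) • ∂_{m} (∂_{m} φ) x‖ :=
      norm_add₃_le
    _ = |deriv (deriv H) (u x) * ∂_{m} u x * ∂_{m} u x + deriv H (u x) * ∂_{m} (∂_{m} u) x| *
        ‖φ x‖ + 2 * (|deriv H (u x) * ∂_{m} u x| * ‖∂_{m} φ x‖) +
        |H (u x)| * ‖∂_{m} (∂_{m} φ) x‖ := by
      rw [norm_smul, norm_mul, norm_smul, norm_smul, Complex.norm_ofNat]
      rfl
    _ ≤ (B * (∂_{m} u x ^ 2 / (1 + u x)) + B * |∂_{m} (∂_{m} u) x|) * A +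
        2 * (B * |∂_{m} u x| * A) + B * |u x| * A := by
      gcongr
      · exact (abs_add_le _ _).trans (add_le_add e1 e2)
      · exact hH _
    _ = _ := by ring

/-- The truncation `u ↦ H(u) φ` is bounded in the norm `‖(1 - Δ) ·‖` on nonnegative functions. -/
theorem exists_norm_besselOp_one_truncMul_le (φ : 𝓢(EuclideanSpace ℝ (Fin d), ℂ))
    (hφ : HasCompactSupport φ) :
    ∃ C : ℝ, 0 ≤ C ∧ ∀ u : 𝓢(EuclideanSpace ℝ (Fin d), ℝ), (∀ x, 0 ≤ u x) →
      ‖((besselOp 1 (truncMul φ hφ u)).toLp 2 volume : L2 d)‖ ≤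
        C * ‖((besselOp 1 (complexify u)).toLp 2 volume : L2 d)‖ := by
  have hdir : ∀ m : EuclideanSpace ℝ (Fin d), ‖m‖ = 1 → ∃ C : ℝ, 0 ≤ C ∧
      ∀ u : 𝓢(EuclideanSpace ℝ (Fin d), ℝ), (∀ x, 0 ≤ u x) →
      ‖((∂_{m} (∂_{m} (truncMul φ hφ u))).toLp 2 volume : L2 d)‖ ≤
        C * ‖((besselOp 1 (complexify u)).toLp 2 volume : L2 d)‖ := by
    intro m hm
    obtain ⟨K, hK0, hK⟩ := exists_norm_lineDerivOp_truncMul_le φ hφ m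
    -- Squaring a sum of four terms costs 4, and the terms contribute 1 + 4 + 1 + 9 = 15 copies of
    -- N², so the square is at most 60 K²N² ≤ (8KN)².
    refine ⟨8 * K, by positivity, fun u hu => ?_⟩
    obtain ⟨hqi, hq⟩ := integral_sq_lineDerivOp_div_le u hu m
    set N := ‖((besselOp 1 (complexify u)).toLp 2 volume : L2 d)‖ with hN
    have hcx : ∀ r : 𝓢(EuclideanSpace ℝ (Fin d), ℝ), Integrable (fun x => r x ^ 2) ∧
        ∫ x, r x ^ 2 = ‖((complexify r).toLp 2 volume : L2 d)‖ ^ 2 := fun r => by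
      refine ⟨by simpa using integrable_sq_norm (complexify r), ?_⟩
      rw [sq_norm_toLp]
      simp
    have b0 : ∫ x, u x ^ 2 ≤ N ^ 2 := by
      rw [(hcx u).2]
      gcongr
      exact norm_toLp_le_besselOp zero_le_one _
    have b1 : ∫ x, ∂_{m} u x ^ 2 ≤ N ^ 2 := by
      rw [(hcx _).2, ← lineDerivOp_complexify]
      gcongr
      exact norm_lineDerivOp_le_besselOp hm _
    have b2 : ∫ x, ∂_{m} (∂_{m} u) x ^ 2 ≤ N ^ 2 := by
      rw [(hcx _).2, ← lineDerivOp_complexify, ← lineDerivOp_complexify]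
      gcongr
      exact norm_lineDerivOp_lineDerivOp_le_besselOp hm _
    have hi0 := (hcx u).1
    have hi1 := (hcx (∂_{m} u)).1
    have hi2 := (hcx (∂_{m} (∂_{m} u))).1
    refine le_of_sq_le_sq ?_ (by positivity)
    rw [sq_norm_toLp]
    calc ∫ x, ‖∂_{m} (∂_{m} (truncMul φ hφ u)) x‖ ^ 2
        ≤ ∫ x, (4 * K ^ 2) * (u x ^ 2 + 4 * ∂_{m} u x ^ 2 + ∂_{m} (∂_{m} u) x ^ 2 +
            (∂_{m} u x ^ 2 / (1 + u x)) ^ 2) := by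
          refine integral_mono (integrable_sq_norm _)
            ((((hi0.add (hi1.const_mul 4)).add hi2).add hqi).const_mul _) fun x => ?_
          refine (pow_le_pow_left₀ (norm_nonneg _) (hK u hu x) 2).trans ?_
          rw [mul_pow, mul_comm 4, mul_assoc]
          gcongr
          rw [← sq_abs (u x), ← sq_abs (∂_{m} (∂_{m} u) x)]
          have : 4 * ∂_{m} u x ^ 2 = (2 * |∂_{m} u x|) ^ 2 := by rw [mul_pow, sq_abs]; norm_num
          rw [this]
          set a := |u x|
          set b := 2 * |∂_{m} u x|
          set c := |∂_{m} (∂_{m} u) x|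
          set e := ∂_{m} u x ^ 2 / (1 + u x)
          nlinarith [sq_nonneg (a - b), sq_nonneg (a - c), sq_nonneg (a - e), sq_nonneg (b - c),
            sq_nonneg (b - e), sq_nonneg (c - e)]
      _ = (4 * K ^ 2) * ((∫ x, u x ^ 2) + 4 * (∫ x, ∂_{m} u x ^ 2) +
            (∫ x, ∂_{m} (∂_{m} u) x ^ 2) + ∫ x, (∂_{m} u x ^ 2 / (1 + u x)) ^ 2) := by
          have i1 : Integrable fun x => u x ^ 2 + 4 * ∂_{m} u x ^ 2 := hi0.add (hi1.const_mul 4)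
          have i2 : Integrable fun x => u x ^ 2 + 4 * ∂_{m} u x ^ 2 + ∂_{m} (∂_{m} u) x ^ 2 :=
            i1.add hi2
          rw [integral_const_mul, integral_add i2 hqi, integral_add i1 hi2,
            integral_add hi0 (hi1.const_mul 4), integral_const_mul]
      _ ≤ (4 * K ^ 2) * (N ^ 2 + 4 * N ^ 2 + N ^ 2 + 9 * N ^ 2) := by
          gcongr
          exact hq.trans (by gcongr)
      _ ≤ _ := by nlinarith [mul_nonneg (sq_nonneg K) (sq_nonneg N)]
  choose! K hK0 hK using hdir
  obtain ⟨C, hC0, hC⟩ := exists_norm_truncMul_le φ hφ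
  have he : ∀ i : Fin d, ‖(EuclideanSpace.single i (1 : ℝ) : EuclideanSpace ℝ (Fin d))‖ = 1 :=
    fun i => by simp
  refine ⟨C + ∑ i : Fin d, K (EuclideanSpace.single i (1 : ℝ)),
    add_nonneg hC0 (Finset.sum_nonneg fun i _ => hK0 _ (he i)), fun u hu => ?_⟩
  refine (norm_besselOp_one_le _).trans ?_
  rw [add_mul, Finset.sum_mul]
  gcongr with i
  · exact (hC u).trans (by gcongr; exact norm_toLp_le_besselOp zero_le_one _)
  · exact hK _ (he i) u hu

end Truncation

/-! ### Interpolation by the heat semigroup -/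

section Interpolation

theorem summable_pow_natAbs {r : ℝ} (hr0 : 0 ≤ r) (hr1 : r < 1) :
    Summable fun j : ℤ => r ^ j.natAbs := by
  refine Summable.of_nat_of_neg ?_ ?_ <;>
  simpa using summable_geometric_of_lt_one hr0 hr1

theorem sq_rpow_two_pow (β : ℝ) (n : ℕ) : (((2 : ℝ) ^ n) ^ β) ^ 2 = ((4 : ℝ) ^ β) ^ n := by
  rw [Real.rpow_pow_comm (by positivity), Real.rpow_pow_comm (by norm_num), ← pow_mul, mul_comm n,
    pow_mul]
  norm_num

/-- The dyadic sum `∑ 4^{βn} min(1, w / 2^n)²` is comparable to `w^{2β}` for `0 < β < 1`. -/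
theorem exists_tsum_rpow_mul_min_sq_le {β : ℝ} (hβ : 0 < β) (hβ1 : β < 1) :
    ∃ K : ℝ, 0 ≤ K ∧ ∀ w : ℝ, 1 ≤ w →
      ∑' n : ℕ, ENNReal.ofReal (((4 : ℝ) ^ β) ^ n * min 1 (w / 2 ^ n) ^ 2) ≤
        ENNReal.ofReal (K * (w ^ β) ^ 2) := by
  set p : ℝ := (4 : ℝ) ^ β with hp
  have hp1 : 1 < p := Real.one_lt_rpow (by norm_num) hβ
  -- The terms decay geometrically away from the scale 2^n ≈ w: with ratio 1/p below it and p/4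
  -- above it. Hence both β > 0 and β < 1 are needed.
  have hp4 : p < 4 := by
    have := Real.rpow_lt_rpow_of_exponent_lt (x := 4) (by norm_num) hβ1
    rwa [Real.rpow_one] at this
  have hp0 : 0 < p := zero_lt_one.trans hp1
  set r : ℝ := max p⁻¹ (p / 4) with hr
  have hr0 : 0 < r := lt_max_of_lt_left (inv_pos.2 hp0)
  have hr1 : r < 1 := max_lt (inv_lt_one_of_one_lt₀ hp1) (by linarith)
  have hs := summable_pow_natAbs hr0.le hr1
  refine ⟨4 * ∑' j : ℤ, r ^ j.natAbs, mul_nonneg (by norm_num) (tsum_nonneg fun j => by positivity),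
    fun w hw => ?_⟩
  obtain ⟨n₀, h1, h2⟩ := exists_nat_pow_near hw (one_lt_two (α := ℝ))
  have hw0 : 0 < w := zero_lt_one.trans_le hw
  have hpw : p ^ n₀ ≤ (w ^ β) ^ 2 := by
    calc p ^ n₀ = (((2 : ℝ) ^ n₀) ^ β) ^ 2 := by
          rw [hp, sq_rpow_two_pow]
      _ ≤ (w ^ β) ^ 2 := by gcongr
  have key : ∀ n : ℕ, p ^ n * min 1 (w / 2 ^ n) ^ 2 ≤
      4 * (w ^ β) ^ 2 * r ^ ((n : ℤ) - n₀).natAbs := by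
    intro n
    have hmin : 0 ≤ min 1 (w / 2 ^ n) := by positivity
    rcases le_total n n₀ with hn | hn
    · obtain ⟨k, rfl⟩ := Nat.exists_eq_add_of_le hn
      have hk : ((n : ℤ) - (n + k : ℕ)).natAbs = k := by omega
      rw [hk]
      calc p ^ n * min 1 (w / 2 ^ n) ^ 2 ≤ p ^ n * 1 := by
            gcongr
            exact pow_le_one₀ hmin (min_le_left _ _)
        _ = p ^ (n + k) * p⁻¹ ^ k := by
            rw [pow_add, inv_pow, mul_one, mul_assoc, mul_inv_cancel₀ (by positivity), mul_one]
        _ ≤ (w ^ β) ^ 2 * r ^ k := by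
            gcongr
            exact le_max_left _ _
        _ ≤ _ := by
            rw [mul_assoc]
            exact le_mul_of_one_le_left (by positivity) (by norm_num)
    · obtain ⟨k, rfl⟩ := Nat.exists_eq_add_of_le hn
      have hk : (((n₀ + k : ℕ) : ℤ) - n₀).natAbs = k := by omega
      rw [hk]
      calc p ^ (n₀ + k) * min 1 (w / 2 ^ (n₀ + k)) ^ 2
          ≤ p ^ (n₀ + k) * (2 ^ (n₀ + 1) / 2 ^ (n₀ + k)) ^ 2 := by
            gcongr
            exact (min_le_right _ _).trans (by gcongr)
        _ = 4 * p ^ n₀ * (p / 4) ^ k := by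
            rw [show (4 : ℝ) = 2 ^ 2 by norm_num, div_pow, div_pow, ← pow_mul 2 2 k]
            field_simp
            ring
        _ ≤ 4 * (w ^ β) ^ 2 * r ^ k := by
            gcongr
            exact le_max_right _ _
  calc ∑' n : ℕ, ENNReal.ofReal (p ^ n * min 1 (w / 2 ^ n) ^ 2)
      ≤ ∑' n : ℕ, ENNReal.ofReal (4 * (w ^ β) ^ 2) *
          ENNReal.ofReal (r ^ ((n : ℤ) - n₀).natAbs) := by
        refine ENNReal.tsum_le_tsum fun n => ?_
        rw [← ENNReal.ofReal_mul (by positivity)]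
        exact ENNReal.ofReal_le_ofReal (key n)
    _ = ENNReal.ofReal (4 * (w ^ β) ^ 2) *
          ∑' n : ℕ, ENNReal.ofReal (r ^ ((n : ℤ) - n₀).natAbs) := ENNReal.tsum_mul_left
    _ ≤ ENNReal.ofReal (4 * (w ^ β) ^ 2) * ∑' j : ℤ, ENNReal.ofReal (r ^ j.natAbs) := by
        gcongr
        exact ENNReal.tsum_comp_le_tsum_of_injective (f := fun n : ℕ => (n : ℤ) - n₀)
          (fun a b h => by simpa using h) fun j => ENNReal.ofReal (r ^ j.natAbs)
    _ = _ := by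
        rw [← ENNReal.ofReal_tsum_of_nonneg (fun j => by positivity) hs,
          ← ENNReal.ofReal_mul (by positivity)]
        congr 1
        ring

theorem fourier_schwartz_sub (f g : 𝓢(EuclideanSpace ℝ (Fin d), ℂ)) :
    𝓕 (f - g) = 𝓕 f - 𝓕 g :=
  map_sub (fourierCLM ℂ 𝓢(EuclideanSpace ℝ (Fin d), ℂ)) f g

theorem sq_norm_toLp_fourier (f : 𝓢(EuclideanSpace ℝ (Fin d), ℂ)) :
    ‖(f.toLp 2 volume : L2 d)‖ ^ 2 = ∫ ξ, ‖𝓕 f ξ‖ ^ 2 := by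
  rw [← SchwartzMap.norm_fourier_toL2_eq, sq_norm_toLp]

/-- Writing the norms as integrals over frequency lets the dyadic sum be moved inside, so that both
interpolation inequalities are checked at a fixed ξ. -/
theorem ofReal_mul_sq_add_sq_eq_lintegral {a b : ℝ} (ha : 0 ≤ a) (hb : 0 ≤ b)
    (f g : 𝓢(EuclideanSpace ℝ (Fin d), ℂ)) :
    ENNReal.ofReal (a * (‖(f.toLp 2 volume : L2 d)‖ ^ 2 + b * ‖(g.toLp 2 volume : L2 d)‖ ^ 2)) =
      ∫⁻ ξ, ENNReal.ofReal (a * (‖𝓕 f ξ‖ ^ 2 + b * ‖𝓕 g ξ‖ ^ 2)) := by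
  have hf := integrable_sq_norm (𝓕 f)
  have hg := (integrable_sq_norm (𝓕 g)).const_mul b
  have hi : Integrable fun ξ => a * (‖𝓕 f ξ‖ ^ 2 + b * ‖𝓕 g ξ‖ ^ 2) := (hf.add hg).const_mul a
  rw [← ofReal_integral_eq_lintegral_ofReal hi
    (Filter.Eventually.of_forall fun ξ => by positivity), integral_const_mul,
    integral_add hf hg, integral_const_mul, sq_norm_toLp_fourier, sq_norm_toLp_fourier]

/-- The easy half of the real interpolation method: the norm `‖(1 - Δ)^β ·‖` is controlled by
any sequence of approximations. -/
theorem sq_norm_besselOp_le_tsum {β : ℝ} (hβ : 0 < β)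
    (v : 𝓢(EuclideanSpace ℝ (Fin d), ℂ)) (V : ℕ → 𝓢(EuclideanSpace ℝ (Fin d), ℂ)) :
    ENNReal.ofReal (‖((besselOp β v).toLp 2 volume : L2 d)‖ ^ 2) ≤
      ∑' n : ℕ, ENNReal.ofReal (2 * (4 : ℝ) ^ β * ((4 : ℝ) ^ β) ^ n *
        (‖((v - V n).toLp 2 volume : L2 d)‖ ^ 2 +
          (4 ^ n)⁻¹ * ‖((besselOp 1 (V n)).toLp 2 volume : L2 d)‖ ^ 2)) := by
  set p : ℝ := (4 : ℝ) ^ β with hp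
  have hp0 : 0 < p := by positivity
  have h := fun n : ℕ => ofReal_mul_sq_add_sq_eq_lintegral
    (a := 2 * p * p ^ n) (b := (4 ^ n)⁻¹) (by positivity) (by positivity) (v - V n)
    (besselOp 1 (V n))
  simp only [h]
  have h0 := ofReal_mul_sq_add_sq_eq_lintegral zero_le_one le_rfl (besselOp β v) 0
  simp only [one_mul, zero_mul, add_zero] at h0
  rw [h0, ← lintegral_tsum fun n => by
    have h1 := (𝓕 (v - V n)).continuous
    have h2 := (𝓕 (besselOp 1 (V n))).continuous
    exact (ENNReal.continuous_ofReal.comp (by fun_prop)).aemeasurable]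
  refine lintegral_mono fun ξ => ?_
  -- At a given frequency the single dyadic scale 2^n ≤ `weight ξ` < 2^{n+1} already dominates.
  -- Passing to the exponent n + 1 costs the extra factor 4^β, and splitting v = (v - V n) + V n
  -- costs the factor 2.
  obtain ⟨n, h1, h2⟩ := exists_nat_pow_near (one_le_weight ξ) (one_lt_two (α := ℝ))
  refine le_trans (ENNReal.ofReal_le_ofReal ?_) (ENNReal.le_tsum n)
  have hw0 := weight_pos ξ
  rw [norm_fourier_besselOp, norm_fourier_besselOp, Real.rpow_one, mul_pow]
  have hpw : (weight ξ ^ β) ^ 2 ≤ p * p ^ n := by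
    calc (weight ξ ^ β) ^ 2 ≤ (((2 : ℝ) ^ (n + 1)) ^ β) ^ 2 := by gcongr
      _ = p * p ^ n := by
          rw [← pow_succ', hp, sq_rpow_two_pow]
  have hV : ‖𝓕 (V n) ξ‖ ^ 2 ≤ (4 ^ n)⁻¹ * (weight ξ * ‖𝓕 (V n) ξ‖) ^ 2 := by
    rw [le_inv_mul_iff₀ (by positivity), show (4 : ℝ) = 2 ^ 2 by norm_num, pow_right_comm,
      ← mul_pow]
    gcongr
  have hv : ‖𝓕 v ξ‖ ^ 2 ≤ 2 * (‖𝓕 (v - V n) ξ‖ ^ 2 + ‖𝓕 (V n) ξ‖ ^ 2) := by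
    have : 𝓕 v ξ = 𝓕 (v - V n) ξ + 𝓕 (V n) ξ := by
      rw [← _root_.add_apply, ← FourierTransform.fourier_add, sub_add_cancel]
    rw [this]
    refine (pow_le_pow_left₀ (norm_nonneg _) (norm_add_le _ _) 2).trans ?_
    nlinarith [sq_nonneg (‖𝓕 (v - V n) ξ‖ - ‖𝓕 (V n) ξ‖)]
  calc (weight ξ ^ β) ^ 2 * ‖𝓕 v ξ‖ ^ 2
      ≤ (p * p ^ n) * (2 * (‖𝓕 (v - V n) ξ‖ ^ 2 +
          (4 ^ n)⁻¹ * (weight ξ * ‖𝓕 (V n) ξ‖) ^ 2)) := by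
        gcongr
        exact hv.trans (by gcongr)
    _ = _ := by ring

/-- The heat semigroup provides approximations realising the interpolation norm. -/
theorem exists_tsum_heat_le {β : ℝ} (hβ : 0 < β) (hβ1 : β < 1) :
    ∃ K : ℝ, 0 ≤ K ∧ ∀ (u : 𝓢(EuclideanSpace ℝ (Fin d), ℂ))
      (U : ℕ → 𝓢(EuclideanSpace ℝ (Fin d), ℂ)),
      (∀ n ξ, 𝓕 (U n) ξ = Real.exp (-((2 ^ n)⁻¹ * weight ξ)) • 𝓕 u ξ) →
      ∑' n : ℕ, ENNReal.ofReal (((4 : ℝ) ^ β) ^ n *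
        (‖((u - U n).toLp 2 volume : L2 d)‖ ^ 2 +
          (4 ^ n)⁻¹ * ‖((besselOp 1 (U n)).toLp 2 volume : L2 d)‖ ^ 2)) ≤
        ENNReal.ofReal (K * ‖((besselOp β u).toLp 2 volume : L2 d)‖ ^ 2) := by
  obtain ⟨K, hK0, hK⟩ := exists_tsum_rpow_mul_min_sq_le hβ hβ1
  refine ⟨2 * K, by positivity, fun u U hU => ?_⟩
  set p : ℝ := (4 : ℝ) ^ β with hp
  have hp0 : 0 < p := by positivity
  have h := fun n : ℕ => ofReal_mul_sq_add_sq_eq_lintegral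
    (a := p ^ n) (b := (4 ^ n)⁻¹) (by positivity) (by positivity) (u - U n)
    (besselOp 1 (U n))
  simp only [h]
  have h0 := ofReal_mul_sq_add_sq_eq_lintegral (a := 2 * K) (by positivity) le_rfl (besselOp β u) 0
  simp only [zero_mul, add_zero] at h0
  rw [h0, ← lintegral_tsum fun n => by
    have h1 := (𝓕 (u - U n)).continuous
    have h2 := (𝓕 (besselOp 1 (U n))).continuous
    exact (ENNReal.continuous_ofReal.comp (by fun_prop)).aemeasurable]
  refine lintegral_mono fun ξ => ?_
  have hw0 := weight_pos ξ
  have hterm : ∀ n : ℕ, p ^ n * (‖𝓕 (u - U n) ξ‖ ^ 2 + (4 ^ n)⁻¹ * ‖𝓕 (besselOp 1 (U n)) ξ‖ ^ 2) ≤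
      (2 * ‖𝓕 u ξ‖ ^ 2) * (p ^ n * min 1 (weight ξ / 2 ^ n) ^ 2) := by
    intro n
    set x := weight ξ / 2 ^ n with hx
    have hx0 : 0 < x := by positivity
    have hxe : (2 ^ n)⁻¹ * weight ξ = x := by rw [hx, div_eq_inv_mul]
    have e0 : 𝓕 (u - U n) ξ = (1 - Real.exp (-x)) • 𝓕 u ξ := by
      rw [fourier_schwartz_sub, _root_.sub_apply, hU, hxe, sub_smul, one_smul]
    have hexp1 : Real.exp (-x) ≤ 1 := Real.exp_le_one_iff.2 (by linarith)
    -- Both 1 - e^{-x} and, below, x e^{-x} are at most min(1, x), which reduces the sum to the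
    -- scalar dyadic estimate.
    have e1 : ‖𝓕 (u - U n) ξ‖ ≤ min 1 x * ‖𝓕 u ξ‖ := by
      rw [e0, norm_smul, Real.norm_of_nonneg (by linarith)]
      gcongr
      exact le_min (by linarith [Real.exp_pos (-x)]) (by linarith [Real.add_one_le_exp (-x)])
    have e2 : (4 ^ n)⁻¹ * ‖𝓕 (besselOp 1 (U n)) ξ‖ ^ 2 ≤ (min 1 x * ‖𝓕 u ξ‖) ^ 2 := by
      have : (4 ^ n)⁻¹ * ‖𝓕 (besselOp 1 (U n)) ξ‖ ^ 2 = (x * Real.exp (-x) * ‖𝓕 u ξ‖) ^ 2 := by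
        rw [norm_fourier_besselOp, hU, norm_smul, hxe, Real.norm_of_nonneg (Real.exp_pos _).le,
          Real.rpow_one, hx, show (4 : ℝ) = 2 ^ 2 by norm_num, pow_right_comm]
        field_simp
      rw [this]
      gcongr
      refine le_min ?_ (mul_le_of_le_one_right hx0.le hexp1)
      rw [Real.exp_neg, ← div_eq_mul_inv, div_le_one (Real.exp_pos x)]
      linarith [Real.add_one_le_exp x]
    calc _ ≤ p ^ n * ((min 1 x * ‖𝓕 u ξ‖) ^ 2 + (min 1 x * ‖𝓕 u ξ‖) ^ 2) := by gcongr
      _ = _ := by ring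
  calc _ ≤ ∑' n : ℕ, ENNReal.ofReal (2 * ‖𝓕 u ξ‖ ^ 2) *
        ENNReal.ofReal (p ^ n * min 1 (weight ξ / 2 ^ n) ^ 2) := by
        refine ENNReal.tsum_le_tsum fun n => ?_
        rw [← ENNReal.ofReal_mul (by positivity)]
        exact ENNReal.ofReal_le_ofReal (hterm n)
    _ = ENNReal.ofReal (2 * ‖𝓕 u ξ‖ ^ 2) * _ := ENNReal.tsum_mul_left
    _ ≤ ENNReal.ofReal (2 * ‖𝓕 u ξ‖ ^ 2) * ENNReal.ofReal (K * (weight ξ ^ β) ^ 2) := by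
        gcongr
        exact hK _ (one_le_weight ξ)
    _ = _ := by
        rw [← ENNReal.ofReal_mul (by positivity), norm_fourier_besselOp]
        congr 1
        ring

/-- The truncation `u ↦ H(u) φ` is bounded in the norm `‖(1 - Δ)^β ·‖` on nonnegative
functions, for `0 < β ≤ 1`. -/
theorem exists_norm_besselOp_truncMul_le {β : ℝ} (hβ : 0 < β) (hβ1 : β ≤ 1)
    (φ : 𝓢(EuclideanSpace ℝ (Fin d), ℂ)) (hφ : HasCompactSupport φ) :
    ∃ C : ℝ, 0 ≤ C ∧ ∀ u : 𝓢(EuclideanSpace ℝ (Fin d), ℝ), (∀ x, 0 ≤ u x) →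
      ‖((besselOp β (truncMul φ hφ u)).toLp 2 volume : L2 d)‖ ≤
        C * ‖((besselOp β (complexify u)).toLp 2 volume : L2 d)‖ := by
  rcases hβ1.eq_or_lt with rfl | hβ1
  · exact exists_norm_besselOp_one_truncMul_le φ hφ
  obtain ⟨C1, hC10, hC1⟩ := exists_norm_truncMul_sub_le φ hφ
  obtain ⟨C2, hC20, hC2⟩ := exists_norm_besselOp_one_truncMul_le φ hφ
  obtain ⟨K, hK0, hK⟩ := exists_tsum_heat_le (d := d) hβ hβ1
  set p : ℝ := (4 : ℝ) ^ β with hp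
  have hp0 : 0 < p := by positivity
  set M : ℝ := 2 * p * (C1 ^ 2 + C2 ^ 2) with hM
  have hM0 : 0 ≤ M := by positivity
  refine ⟨Real.sqrt (M * K), Real.sqrt_nonneg _, fun u hu => ?_⟩
  have hheat := fun n : ℕ =>
    exists_complexify_eq_heat (t := (2 ^ n)⁻¹) (by positivity) u hu
  choose U hU0 hU using hheat
  refine le_of_sq_le_sq ?_ (by positivity)
  rw [mul_pow, Real.sq_sqrt (by positivity), mul_assoc]
  rw [← ENNReal.ofReal_le_ofReal_iff (by positivity)]
  -- The truncation of u is approximated by the truncations of its heat evolutions at times 2^{-n}.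
  -- These evolutions stay nonnegative, so the second-order bound applies to each, while the
  -- Lipschitz bound controls the differences.
  calc _ ≤ _ := sq_norm_besselOp_le_tsum hβ (truncMul φ hφ u) fun n => truncMul φ hφ (U n)
    _ ≤ ∑' n : ℕ, ENNReal.ofReal M * ENNReal.ofReal (p ^ n *
        (‖((complexify u - complexify (U n)).toLp 2 volume : L2 d)‖ ^ 2 +
          (4 ^ n)⁻¹ * ‖((besselOp 1 (complexify (U n))).toLp 2 volume : L2 d)‖ ^ 2)) := by
        refine ENNReal.tsum_le_tsum fun n => ?_
        rw [← ENNReal.ofReal_mul hM0]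
        refine ENNReal.ofReal_le_ofReal ?_
        have h1 := pow_le_pow_left₀ (norm_nonneg _) (hC1 u (U n)) 2
        have h2 := pow_le_pow_left₀ (norm_nonneg _) (hC2 (U n) (hU0 n)) 2
        rw [mul_pow] at h1 h2
        set a := ‖((complexify u - complexify (U n)).toLp 2 volume : L2 d)‖ ^ 2 with ha
        set b := ‖((besselOp 1 (complexify (U n))).toLp 2 volume : L2 d)‖ ^ 2 with hb
        calc _ ≤ 2 * p * p ^ n * (C1 ^ 2 * a + (4 ^ n)⁻¹ * (C2 ^ 2 * b)) := by gcongr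
          _ ≤ 2 * p * p ^ n * ((C1 ^ 2 + C2 ^ 2) * a + (4 ^ n)⁻¹ * ((C1 ^ 2 + C2 ^ 2) * b)) := by
              gcongr
              · exact le_add_of_nonneg_right (sq_nonneg _)
              · exact le_add_of_nonneg_left (sq_nonneg _)
          _ = _ := by ring
    _ = ENNReal.ofReal M * _ := ENNReal.tsum_mul_left
    _ ≤ ENNReal.ofReal M * _ := by
        gcongr
        exact hK (complexify u) (fun n => complexify (U n)) hU
    _ = _ := (ENNReal.ofReal_mul hM0).symm

end Interpolation

/-! ### Zero capacity implies density -/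

section Density

open Filter Topology

theorem tendsto_norm_toLp_of_dominated {v : ℕ → 𝓢(EuclideanSpace ℝ (Fin d), ℂ)}
    {b : EuclideanSpace ℝ (Fin d) → ℝ} (hb : Integrable b) (hvb : ∀ n x, ‖v n x‖ ^ 2 ≤ b x)
    (hv : ∀ x, Tendsto (fun n => v n x) atTop (𝓝 0)) :
    Tendsto (fun n => ‖((v n).toLp 2 volume : L2 d)‖) atTop (𝓝 0) := by
  have h : Tendsto (fun n => ∫ x, ‖v n x‖ ^ 2) atTop (𝓝 (∫ _ : EuclideanSpace ℝ (Fin d), 0)) := by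
    refine tendsto_integral_of_dominated_convergence b
      (fun n => (integrable_sq_norm (v n)).aestronglyMeasurable) hb
      (fun n => Eventually.of_forall fun x => ?_) (Eventually.of_forall fun x => ?_)
    · rw [Real.norm_of_nonneg (by positivity)]
      exact hvb n x
    · simpa using (hv x).norm.pow 2
  simp only [← sq_norm_toLp, integral_zero] at h
  have h2 := h.sqrt
  simpa [Real.sqrt_sq] using h2

theorem exists_schwartz_bump : ∃ χ : 𝓢(EuclideanSpace ℝ (Fin d), ℝ),
    HasCompactSupport χ ∧ χ 0 = 1 := by
  let f : ContDiffBump (0 : EuclideanSpace ℝ (Fin d)) := ⟨1, 2, one_pos, one_lt_two⟩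
  exact ⟨f.hasCompactSupport.toSchwartzMap f.contDiff, f.hasCompactSupport,
    f.one_of_mem_closedBall (Metric.mem_closedBall_self f.rIn_pos.le)⟩

theorem hasLineDerivAt_schwartz_smul (χ : 𝓢(EuclideanSpace ℝ (Fin d), ℝ)) (c : ℝ)
    (m x : EuclideanSpace ℝ (Fin d)) :
    HasLineDerivAt ℝ (fun y => χ (c • y)) (c * ∂_{m} χ (c • x)) x m := by
  rw [SchwartzMap.lineDerivOp_apply_eq_fderiv]
  have h2 := (χ.differentiableAt (x := c • x)).hasFDerivAt.comp x
    ((hasFDerivAt_id (𝕜 := ℝ) x).const_smul c)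
  simpa [Function.comp_def] using h2.hasLineDerivAt m

/-- Compactly supported smooth functions are dense in the norm `‖(1 - Δ) ·‖` in the Schwartz
space. -/
theorem exists_seq_tendsto_besselOp_one (φ : 𝓢(EuclideanSpace ℝ (Fin d), ℂ)) :
    ∃ v : ℕ → 𝓢(EuclideanSpace ℝ (Fin d), ℂ), (∀ n, HasCompactSupport (φ - v n)) ∧
      Tendsto (fun n => ‖((besselOp 1 (v n)).toLp 2 volume : L2 d)‖) atTop (𝓝 0) := by
  obtain ⟨χ, hχ, hχ1⟩ := exists_schwartz_bump (d := d)
  set c : ℕ → ℝ := fun n => 1 / ((n : ℝ) + 1) with hc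
  have hc0 : ∀ n, 0 < c n := fun n => Nat.one_div_pos_of_nat
  have hc1 : ∀ n, |c n| ≤ 1 := fun n => by
    rw [abs_of_pos (hc0 n), hc, div_le_one (by positivity)]
    linarith [(Nat.cast_nonneg n : (0 : ℝ) ≤ n)]
  have hclim : Tendsto c atTop (𝓝 0) := tendsto_one_div_add_atTop_nhds_zero_nat
  have hw : ∀ n, HasCompactSupport fun x => χ (c n • x) • φ x := fun n =>
    (hχ.comp_smul (hc0 n).ne').smul_right
  have hws : ∀ n, ContDiff ℝ ∞ fun x => χ (c n • x) • φ x := fun n =>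
    ((χ.smooth ⊤).comp (contDiff_const_smul (c n))).smul (φ.smooth ⊤)
  set v : ℕ → 𝓢(EuclideanSpace ℝ (Fin d), ℂ) := fun n => φ - (hw n).toSchwartzMap (hws n) with hv
  have hvx : ∀ n x, v n x = (1 - χ (c n • x)) • φ x := fun n x => by
    rw [sub_smul, one_smul]
    rfl
  have hcx : ∀ x : EuclideanSpace ℝ (Fin d), Tendsto (fun n => c n • x) atTop (𝓝 0) := fun x => by
    simpa using hclim.smul_const x
  have hGlim : ∀ x, Tendsto (fun n => 1 - χ (c n • x)) atTop (𝓝 0) := fun x => by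
    have := (χ.continuous.tendsto 0).comp (hcx x)
    rw [hχ1] at this
    simpa using this.const_sub 1
  refine ⟨v, fun n => ?_, ?_⟩
  · have : φ - v n = (hw n).toSchwartzMap (hws n) := sub_sub_cancel _ _
    rw [this]
    exact hw n
  set A₀ := 1 + SchwartzMap.seminorm ℝ 0 0 χ with hA₀
  have hG : ∀ y, |1 - χ y| ≤ A₀ := fun y => by
    have := SchwartzMap.norm_le_seminorm ℝ χ y
    rw [Real.norm_eq_abs] at this
    have h1 := abs_sub_le 1 0 (χ y)
    rw [sub_zero, abs_one, zero_sub, abs_neg] at h1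
    linarith
  have hv0 : Tendsto (fun n => ‖((v n).toLp 2 volume : L2 d)‖) atTop (𝓝 0) := by
    refine tendsto_norm_toLp_of_dominated ((integrable_sq_norm φ).const_mul (A₀ ^ 2))
      (fun n x => ?_) fun x => ?_
    · rw [hvx, norm_smul, mul_pow]
      gcongr
      exact hG _
    · simpa only [hvx, zero_smul] using (hGlim x).smul_const (φ x)
  have hv2 : ∀ m : EuclideanSpace ℝ (Fin d),
      Tendsto (fun n => ‖((∂_{m} (∂_{m} (v n))).toLp 2 volume : L2 d)‖) atTop (𝓝 0) := by
    intro m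
    -- Each derivative falling on the dilated cutoff brings a factor c n → 0; the remaining term
    -- tends to 0 pointwise because χ(0) = 1.
    have e : ∀ n x, ∂_{m} (∂_{m} (v n)) x = (-(c n * (c n * ∂_{m} (∂_{m} χ) (c n • x)))) • φ x +
        2 * ((-(c n * ∂_{m} χ (c n • x))) • ∂_{m} φ x) +
        (1 - χ (c n • x)) • ∂_{m} (∂_{m} φ) x := fun n =>
      lineDerivOp_lineDerivOp_of_eq_smul (G := fun x => 1 - χ (c n • x))
        (G1 := fun x => -(c n * ∂_{m} χ (c n • x)))
        (G2 := fun x => -(c n * (c n * ∂_{m} (∂_{m} χ) (c n • x))))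
        (fun x => HasDerivAt.const_sub 1 (hasLineDerivAt_schwartz_smul χ (c n) m x))
        (fun x => HasDerivAt.neg (HasDerivAt.const_mul (c n)
          (hasLineDerivAt_schwartz_smul (∂_{m} χ) (c n) m x))) (hvx n)
    set A₁ := SchwartzMap.seminorm ℝ 0 0 (∂_{m} χ) with hA₁
    set A₂ := SchwartzMap.seminorm ℝ 0 0 (∂_{m} (∂_{m} χ)) with hA₂
    have h1 : ∀ y, |∂_{m} χ y| ≤ A₁ := SchwartzMap.norm_le_seminorm ℝ (∂_{m} χ)
    have h2 : ∀ y, |∂_{m} (∂_{m} χ) y| ≤ A₂ := SchwartzMap.norm_le_seminorm ℝ (∂_{m} (∂_{m} χ))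
    have hG1 : ∀ n y, |-(c n * ∂_{m} χ y)| ≤ A₁ := fun n y => by
      rw [abs_neg, abs_mul]
      exact (mul_le_of_le_one_left (abs_nonneg _) (hc1 n)).trans (h1 y)
    have hG2 : ∀ n y, |-(c n * (c n * ∂_{m} (∂_{m} χ) y))| ≤ A₂ := fun n y => by
      rw [abs_neg, abs_mul, abs_mul]
      refine (mul_le_of_le_one_left (by positivity) (hc1 n)).trans ?_
      exact (mul_le_of_le_one_left (abs_nonneg _) (hc1 n)).trans (h2 y)
    refine tendsto_norm_toLp_of_dominated
      (b := fun x => 3 * ((A₂ ^ 2 * ‖φ x‖ ^ 2 + 4 * A₁ ^ 2 * ‖∂_{m} φ x‖ ^ 2) +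
        A₀ ^ 2 * ‖∂_{m} (∂_{m} φ) x‖ ^ 2)) ?_ (fun n x => ?_) fun x => ?_
    · exact ((((integrable_sq_norm φ).const_mul _).add
        ((integrable_sq_norm (∂_{m} φ)).const_mul _)).add
        ((integrable_sq_norm (∂_{m} (∂_{m} φ))).const_mul _)).const_mul 3
    · rw [e]
      have hle : ‖(-(c n * (c n * ∂_{m} (∂_{m} χ) (c n • x)))) • φ x +
          2 * ((-(c n * ∂_{m} χ (c n • x))) • ∂_{m} φ x) +
          (1 - χ (c n • x)) • ∂_{m} (∂_{m} φ) x‖ ≤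
          A₂ * ‖φ x‖ + 2 * (A₁ * ‖∂_{m} φ x‖) + A₀ * ‖∂_{m} (∂_{m} φ) x‖ := by
        refine norm_add₃_le.trans ?_
        rw [norm_smul, norm_mul, norm_smul, norm_smul, Complex.norm_ofNat]
        gcongr
        exacts [hG2 _ _, hG1 _ _, hG _]
      refine (pow_le_pow_left₀ (norm_nonneg _) hle 2).trans ?_
      set p := A₂ * ‖φ x‖ with hp
      set q := A₁ * ‖∂_{m} φ x‖ with hq
      set r := A₀ * ‖∂_{m} (∂_{m} φ) x‖ with hr
      have : 3 * ((A₂ ^ 2 * ‖φ x‖ ^ 2 + 4 * A₁ ^ 2 * ‖∂_{m} φ x‖ ^ 2) +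
          A₀ ^ 2 * ‖∂_{m} (∂_{m} φ) x‖ ^ 2) = 3 * (p ^ 2 + 4 * q ^ 2 + r ^ 2) := by
        rw [hp, hq, hr]; ring
      rw [this]
      nlinarith [sq_nonneg (p - 2 * q), sq_nonneg (p - r), sq_nonneg (2 * q - r)]
    · simp only [e]
      have t1 : Tendsto (fun n => ∂_{m} χ (c n • x)) atTop (𝓝 (∂_{m} χ 0)) :=
        ((∂_{m} χ : 𝓢(EuclideanSpace ℝ (Fin d), ℝ)).continuous.tendsto 0).comp (hcx x)
      have t2 : Tendsto (fun n => ∂_{m} (∂_{m} χ) (c n • x)) atTop (𝓝 (∂_{m} (∂_{m} χ) 0)) :=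
        ((∂_{m} (∂_{m} χ) : 𝓢(EuclideanSpace ℝ (Fin d), ℝ)).continuous.tendsto 0).comp (hcx x)
      have := (((hclim.mul (hclim.mul t2)).neg.smul_const (φ x)).add
        (((hclim.mul t1).neg.smul_const (∂_{m} φ x)).const_mul 2)).add
        ((hGlim x).smul_const (∂_{m} (∂_{m} φ) x))
      simpa using this
  have hsum := hv0.add (tendsto_finsetSum Finset.univ fun (i : Fin d) _ =>
    hv2 (EuclideanSpace.single i (1 : ℝ)))
  simp only [Finset.sum_const_zero, add_zero] at hsum
  exact squeeze_zero (fun n => norm_nonneg _) (fun n => norm_besselOp_one_le (v n)) hsum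

theorem inner_besselOp_eq_zero_of_capacity_eq_zero {α : ℝ} (hα : 0 < α) (hα2 : α ≤ 2)
    {S : Set (EuclideanSpace ℝ (Fin d))} (hS : IsCompact S) (hcap : capacity α S = 0)
    {k : L2 d} (hk : ∀ φ : 𝓢(EuclideanSpace ℝ (Fin d), ℂ), HasCompactSupport φ →
      tsupport φ ⊆ Sᶜ → inner ℂ k ((besselOp (α / 2) φ).toLp 2) = 0)
    (φ : 𝓢(EuclideanSpace ℝ (Fin d), ℂ)) (hφ : HasCompactSupport φ) :
    inner ℂ k ((besselOp (α / 2) φ).toLp 2) = 0 := by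
  obtain ⟨C, hC0, hC⟩ := exists_norm_besselOp_truncMul_le (β := α / 2) (by linarith)
    (by linarith) φ hφ
  refine norm_eq_zero.1 (le_antisymm (le_of_forall_pos_le_add fun ε hε => ?_) (norm_nonneg _))
  rw [zero_add]
  -- The added 1 keeps the denominator positive when ‖k‖ C = 0, and the quotient ‖k‖ C / (‖k‖ C + 1)
  -- stays below 1.
  obtain ⟨s, hs0, hs, U, hU, hSU, hsU⟩ := exists_besselOp_le_of_capacity_eq_zero hα hS hcap
    (ε := ε / (‖k‖ * C + 1)) (by positivity)
  -- The step function equals 1 wherever s ≥ 1. Vanishing on a whole neighbourhood of `S` keeps the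
  -- closed support of the difference away from `S`.
  have hzero : ∀ x ∈ U, (φ - truncMul φ hφ s) x = 0 := fun x hx => by
    rw [_root_.sub_apply, truncMul_apply, Real.smoothTransition.one_of_one_le (hsU x hx), one_smul,
      sub_self]
  have h1 := hk (φ - truncMul φ hφ s)
    (hφ.sub (hφ.smul_left (f := fun x => Real.smoothTransition (s x)))) (by
      have : tsupport (φ - truncMul φ hφ s) ⊆ Uᶜ :=
        closure_minimal (fun x hx hxU => hx (hzero x hxU)) hU.isClosed_compl
      exact this.trans (Set.compl_subset_compl.2 hSU))
  rw [map_sub, toLp_sub, inner_sub_right, sub_eq_zero] at h1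
  rw [h1]
  refine (norm_inner_le_norm _ _).trans ?_
  calc ‖k‖ * ‖((besselOp (α / 2) (truncMul φ hφ s)).toLp 2 volume : L2 d)‖
      ≤ ‖k‖ * (C * (ε / (‖k‖ * C + 1))) := by
        gcongr
        exact (hC s hs0).trans (by gcongr)
    _ = ‖k‖ * C / (‖k‖ * C + 1) * ε := by ring
    _ ≤ ε := mul_le_of_le_one_left hε.le ((div_le_one (by positivity)).2 (by linarith))

/-- Orthogonality extends from compactly supported to all Schwartz φ, because α/2 ≤ 1 makes
approximation in the norm ‖(1 - Δ) ·‖ sufficient. As (1 - Δ)^{α/2} maps the Schwartz space onto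
itself, `k` is orthogonal to a dense subspace. -/
theorem eq_zero_of_capacity_eq_zero {α : ℝ} (hα : 0 < α) (hα2 : α ≤ 2)
    {S : Set (EuclideanSpace ℝ (Fin d))} (hS : IsCompact S) (hcap : capacity α S = 0)
    {k : L2 d} (hk : ∀ φ : 𝓢(EuclideanSpace ℝ (Fin d), ℂ), HasCompactSupport φ →
      tsupport φ ⊆ Sᶜ → inner ℂ k ((besselOp (α / 2) φ).toLp 2) = 0) : k = 0 := by
  have h1 : ∀ φ : 𝓢(EuclideanSpace ℝ (Fin d), ℂ),
      inner ℂ k ((besselOp (α / 2) φ).toLp 2) = 0 := by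
    intro φ
    obtain ⟨v, hv, hlim⟩ := exists_seq_tendsto_besselOp_one φ
    have h2 : ∀ n, ‖(inner ℂ k ((besselOp (α / 2) φ).toLp 2) : ℂ)‖ ≤
        ‖k‖ * ‖((besselOp 1 (v n)).toLp 2 volume : L2 d)‖ := by
      intro n
      have h3 := inner_besselOp_eq_zero_of_capacity_eq_zero hα hα2 hS hcap hk _ (hv n)
      rw [map_sub, toLp_sub, inner_sub_right, sub_eq_zero] at h3
      rw [h3]
      refine (norm_inner_le_norm _ _).trans ?_
      gcongr
      exact norm_besselOp_le_besselOp (by linarith) _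
    have h4 := ge_of_tendsto' (hlim.const_mul ‖k‖) h2
    rw [mul_zero] at h4
    exact norm_eq_zero.1 (le_antisymm h4 (norm_nonneg _))
  have h2 : ∀ g : 𝓢(EuclideanSpace ℝ (Fin d), ℂ), inner ℂ k (g.toLp 2 volume : L2 d) = 0 := by
    intro g
    have := h1 (besselOp (-(α / 2)) g)
    rwa [besselOp_besselOp, add_neg_cancel, besselOp_zero] at this
  exact (SchwartzMap.denseRange_toLpCLM (F := ℂ) (p := 2)
    (μ := (volume : Measure (EuclideanSpace ℝ (Fin d))))
    ENNReal.ofNat_ne_top).eq_zero_of_inner_left ℂ h2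

theorem isEssentiallySelfAdjoint_fracLaplacian_iff_capacity {α : ℝ} (hα : 0 < α) (hα2 : α ≤ 2)
    {S : Set (EuclideanSpace ℝ (Fin d))} (hS : IsCompact S) (hS0 : volume S = 0) :
    IsEssentiallySelfAdjoint (fracLaplacian hα S) ↔ capacity α S = 0 := by
  rw [isEssentiallySelfAdjoint_fracLaplacian_iff hα hS.isClosed hS0]
  exact ⟨capacity_eq_zero_of_forall_inner hα hS,
    fun hcap _ hk => eq_zero_of_capacity_eq_zero hα hα2 hS hcap hk⟩

end Density

end FractionalLaplacian

theorem theorem3p2 (d : ℕ) (α : ℝ) (hα : 0 < α) (hα2 : α ≤ 2)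
    (S : Set (EuclideanSpace ℝ (Fin d))) (hS : IsCompact S) (hS0 : volume S = 0) :
    IsEssentiallySelfAdjoint (FractionalLaplacian.fracLaplacian hα S) ↔
      FractionalLaplacian.capacity α S = 0 :=
  FractionalLaplacian.isEssentiallySelfAdjoint_fracLaplacian_iff_capacity hα hα2 hS hS0
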